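/- Let $R\ge 1$, $K\ge 1$, $T=2R$, let $L_1,\dots,L_K$ be positive integers, let $u_{t\nu}\in\{1,\dots,L_\nu-1\}$ for $1\le t\le 2R$, $1\le \nu\le K$, and put $$\mathbf D_\nu=\mathrm{diag}\bigl(e^{2\pi \mathrm{i}\,u_{1\nu}/L_\nu},\dots,e^{2\pi \mathrm{i}\,u_{2R,\nu}/L_\nu}\bigr),\qquad \mathbf D^{l}=\prod_{\nu=1}^K\mathbf D_\nu^{l_\nu}$$ for $l=(l_1,\dots,l_K)$ with $1\le l_\nu\le L_\nu$. Let $\mathbf M$ be an $R\times R$ generalized Butson--Hadamard matrix, i.e. $\mathbf M\mathbf M^H=\mathbf M^H\mathbf M=R\,\mathbf I_R$ and $m_{ij}^*=m_{ij}^{-1}$ for all entries; let $\mathbf\Gamma=[\mathbf M^T\ \mathbf M^T]^T$, $\mathbf A_j=\mathrm{diag}(\mathbf\Gamma_{1j},\dots,\mathbf\Gamma_{2R,j})$ and $\mathbf x=\frac1{\sqrt{2R}}[1\,\cdots\,1]^T$. The non-differential abelian distributed space-time block code has the codewords $\mathbf S_l=[\mathbf A_1\mathbf D^l\mathbf x\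 \cdots\ \mathbf A_R\mathbf D^l\mathbf x]=\frac1{\sqrt{2R}}\mathbf D^l\mathbf\Gamma$. It is used in a network with one source, $R$ relays and one destination. For a message $l$, uniformly distributed, relay $j$ receives $\mathbf r_j=\sqrt{P_1T}\,f_j\mathbf D^l\mathbf x+\mathbf n_j$ and sends $\mathbf t_j=\sqrt{P_2/(1+P_1)}\,\mathbf A_j\mathbf r_j$, and the destination receives $\mathbf y=\sum_j g_j\mathbf t_j+\mathbf w$; all $f_j$, $g_j$ and all entries of $\mathbf n_j$, $\mathbf w$ are independent circularly symmetric complex Gaussian variables with mean $0$ and variance $1$. The destination knows the $g_j$ but not the $f_j$, and uses a maximum-likelihood decoder, i.e. it returns a message maximizing the conditional density of $\mathbf y$ given $\mathbf S_l$ and $(g_j)$, ties being broken in any measurable way. The total power $P=P_1+RP_2$ is shared in a fixed proportion, $P_1=\alpha P$, $P_2=(1-\alpha)P/R$ with $0<\alpha<1$. The diversity order is $d$ if the block error rate $P_e(P)$ is positive for all large $P$ and $-\log P_e(P)/\log P\to d$ as $P\to\infty$. Then the diversity order is $R$ if and only if, for each $i=1,\dots,R$ and all $l\ne\hat l$, $$\sum_{\nu=1}^K\frac{(l_\nu-\hat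 l_\nu)(u_{i\nu}-u_{(R+i)\nu})}{L_\nu}\notin\mathbb Z .$$ The same condition is also necessary and sufficient for the determinant criterion: $\det(\mathbf S_{l\hat l}^H\mathbf S_{l\hat l})\neq0$ for all $l\ne\hat l$, where $\mathbf S_{l\hat l}=[\mathbf S_l\ \mathbf S_{\hat l}]$. -/

import Mathlib

open MeasureTheory ProbabilityTheory Filter Topology

noncomputable section

namespace RelayNetwork

/-! ### The code

With `R` relays a codeword lasts `T = 2R` channel uses. These `2R` coordinates are indexed by
`Fin R ⊕ Fin R`: the coordinate `i ≤ R` is `Sum.inl i`, the coordinate `R + i` is `Sum.inr i`. -/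

/-- The `2R` coordinates (channel uses). -/
abbrev Slot (R : ℕ) := Fin R ⊕ Fin R

/-- Multi-indices `l = (l₁, …, l_K)` with `1 ≤ l_ν ≤ L_ν`; the value `l_ν` is `(l ν : ℕ) + 1`. -/
abbrev Message {K : ℕ} (L : Fin K → ℕ) := (ν : Fin K) → Fin (L ν)

/-- Generalized Butson-Hadamard matrices: `M Mᴴ = Mᴴ M = R I`, and the conjugate of every entry
is its inverse. -/
structure IsGBH {R : ℕ} (M : Matrix (Fin R) (Fin R) ℂ) : Prop where
  mul_conjTranspose : M * M.conjTranspose = (R : ℂ) • (1 : Matrix (Fin R) (Fin R) ℂ)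
  conjTranspose_mul : M.conjTranspose * M = (R : ℂ) • (1 : Matrix (Fin R) (Fin R) ℂ)
  entry_mul_conj : ∀ i j, M i j * star (M i j) = 1

/-- The `2R × R` matrix `Γ = [Mᵀ Mᵀ]ᵀ`. -/
def gammaMatrix {R : ℕ} (M : Matrix (Fin R) (Fin R) ℂ) : Matrix (Slot R) (Fin R) ℂ :=
  Matrix.fromRows M M

/-- The matrix `A_j = diag (Γ_{1j}, …, Γ_{2R,j})` of the `j`-th relay. -/
def relayMatrix {R : ℕ} (M : Matrix (Fin R) (Fin R) ℂ) (j : Fin R) :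
    Matrix (Slot R) (Slot R) ℂ :=
  Matrix.diagonal fun t => gammaMatrix M t j

/-- The generator `D_ν = diag (exp (2πi u_{1ν} / L_ν), …, exp (2πi u_{2R,ν} / L_ν))`. -/
def generator {R K : ℕ} (L : Fin K → ℕ) (u : Slot R → Fin K → ℕ) (ν : Fin K) :
    Matrix (Slot R) (Slot R) ℂ :=
  Matrix.diagonal fun t => Complex.exp (2 * Real.pi * Complex.I * (u t ν : ℂ) / (L ν : ℂ))

/-- The group element `D^l = D₁^{l₁} ⋯ D_K^{l_K}`. -/
def groupElement {R K : ℕ} (L : Fin K → ℕ) (u : Slot R → Fin K → ℕ) (l : Message L) :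
    Matrix (Slot R) (Slot R) ℂ :=
  (List.ofFn fun ν : Fin K => generator L u ν ^ ((l ν : ℕ) + 1)).prod

/-- The vector `x = (1, …, 1)ᵀ / √(2R)`. -/
def xVector (R : ℕ) : Slot R → ℂ := fun _ => 1 / (Real.sqrt (2 * R) : ℂ)

/-- The vector `D^l x` which the source transmits for the message `l`. -/
def sourceVector {R K : ℕ} (L : Fin K → ℕ) (u : Slot R → Fin K → ℕ) (l : Message L) :
    Slot R → ℂ :=
  (groupElement L u l).mulVec (xVector R)

/-- The codeword `S_l = [A₁ D^l x  ⋯  A_R D^l x]`, a `2R × R` matrix. -/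
def codeword {R K : ℕ} (L : Fin K → ℕ) (u : Slot R → Fin K → ℕ)
    (M : Matrix (Fin R) (Fin R) ℂ) (l : Message L) : Matrix (Slot R) (Fin R) ℂ :=
  Matrix.of fun t j => (relayMatrix M j).mulVec (sourceVector L u l) t

/-- The determinant criterion: `|S_{l l'}ᴴ S_{l l'}| ≠ 0` for the juxtaposition
`S_{l l'} = [S_l  S_{l'}]` of any two codewords with `l ≠ l'`. -/
def DetCriterion {R K : ℕ} (L : Fin K → ℕ) (u : Slot R → Fin K → ℕ)
    (M : Matrix (Fin R) (Fin R) ℂ) : Prop :=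
  ∀ l l' : Message L, l ≠ l' →
    ((Matrix.fromCols (codeword L u M l) (codeword L u M l')).conjTranspose *
      Matrix.fromCols (codeword L u M l) (codeword L u M l')).det ≠ 0

/-! ### The channel -/

/-- The law of a circularly symmetric complex Gaussian variable of mean `0` and variance `1`:
real and imaginary parts are independent real Gaussians of mean `0` and variance `1/2`. -/
def cscg : Measure ℂ :=
  ((gaussianReal 0 (1 / 2)).prod (gaussianReal 0 (1 / 2))).map
    fun p : ℝ × ℝ => (⟨p.1, p.2⟩ : ℂ)

/-- The random quantities: source-relay fadings `f`, relay-destination fadings `g`, the noise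
vectors `n_j` at the relays, and the noise vector `w` at the destination. -/
abbrev Sample (R : ℕ) :=
  (Fin R → ℂ) × (Fin R → ℂ) × (Fin R → Slot R → ℂ) × (Slot R → ℂ)

/-- All these complex variables are independent and standard circularly symmetric Gaussian. -/
def sampleLaw (R : ℕ) : Measure (Sample R) :=
  (Measure.pi fun _ : Fin R => cscg).prod
    ((Measure.pi fun _ : Fin R => cscg).prod
      ((Measure.pi fun _ : Fin R => Measure.pi fun _ : Slot R => cscg).prod
        (Measure.pi fun _ : Slot R => cscg)))

/-- The fadings `g` from the relays to the destination. -/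
def destFading {R : ℕ} (ω : Sample R) : Fin R → ℂ := ω.2.1

/-- First phase: the `j`-th relay receives `r_j = √(P₁ T) f_j s + n_j`, where `T = 2R`. -/
def relayReceived {R : ℕ} (P₁ : ℝ) (s : Slot R → ℂ) (ω : Sample R) (j : Fin R) :
    Slot R → ℂ :=
  ((Real.sqrt (P₁ * (2 * R)) : ℂ) * ω.1 j) • s + ω.2.2.1 j

/-- Second phase: the `j`-th relay sends `t_j = √(P₂ / (1 + P₁)) A_j r_j`. -/
def relayTransmitted {R : ℕ} (P₁ P₂ : ℝ) (M : Matrix (Fin R) (Fin R) ℂ) (s : Slot R → ℂ)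
    (ω : Sample R) (j : Fin R) : Slot R → ℂ :=
  (Real.sqrt (P₂ / (1 + P₁)) : ℂ) • (relayMatrix M j).mulVec (relayReceived P₁ s ω j)

/-- The destination receives `y = ∑ j, g_j t_j + w`. -/
def destReceived {R : ℕ} (P₁ P₂ : ℝ) (M : Matrix (Fin R) (Fin R) ℂ) (s : Slot R → ℂ)
    (ω : Sample R) : Slot R → ℂ :=
  ∑ j, destFading ω j • relayTransmitted P₁ P₂ M s ω j + ω.2.2.2

/-! ### Partially-coherent maximum-likelihood decoding and error rate -/

/-- The covariance `Σ_y = ρ S Σ_h Sᴴ + γ I` of the received vector given `S` and `g`, where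
`ρ = P₁ P₂ T / (P₁ + 1)`, `Σ_h = diag (|g₁|², …, |g_R|²)` and
`γ = 1 + P₂ / (1 + P₁) ∑ j, |g_j|²`. -/
def receivedCov {R : ℕ} (P₁ P₂ : ℝ) (S : Matrix (Slot R) (Fin R) ℂ) (g : Fin R → ℂ) :
    Matrix (Slot R) (Slot R) ℂ :=
  ((P₁ * P₂ * (2 * R) / (P₁ + 1) : ℝ) : ℂ) •
      (S * Matrix.diagonal (fun j => ((‖g j‖ ^ 2 : ℝ) : ℂ)) * S.conjTranspose) +
    ((1 + P₂ / (1 + P₁) * ∑ j, ‖g j‖ ^ 2 : ℝ) : ℂ) • (1 : Matrix (Slot R) (Slot R) ℂ)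

/-- The Gaussian density `exp (- yᴴ Σ_y⁻¹ y) / (π^T |Σ_y|)` of the received vector given the
codeword and `g` (the fadings `f` are unknown to the destination). -/
def likelihood {R : ℕ} (P₁ P₂ : ℝ) (S : Matrix (Slot R) (Fin R) ℂ) (g : Fin R → ℂ)
    (y : Slot R → ℂ) : ℝ :=
  Real.exp (-(dotProduct (star y) ((receivedCov P₁ P₂ S g)⁻¹.mulVec y)).re) /
    (Real.pi ^ (2 * R) * (receivedCov P₁ P₂ S g).det.re)

/-- A decoder, which sees `g` and `y`, is a maximum-likelihood decoder if it always returns a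
message whose codeword maximizes the likelihood. Ties may be broken in any measurable way. -/
structure IsMLDecoder {R K : ℕ} (P₁ P₂ : ℝ) (L : Fin K → ℕ) (u : Slot R → Fin K → ℕ)
    (M : Matrix (Fin R) (Fin R) ℂ) (dec : (Fin R → ℂ) → (Slot R → ℂ) → Message L) :
    Prop where
  measurable : Measurable (Function.uncurry dec)
  maximizes : ∀ g y l, likelihood P₁ P₂ (codeword L u M l) g y ≤
    likelihood P₁ P₂ (codeword L u M (dec g y)) g y

/-- The block error rate: the probability that the decoded message differs from the transmitted
one, which is uniformly distributed over the messages. -/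
def blockErrorRate {R K : ℕ} (P₁ P₂ : ℝ) (L : Fin K → ℕ) (u : Slot R → Fin K → ℕ)
    (M : Matrix (Fin R) (Fin R) ℂ) (dec : (Fin R → ℂ) → (Slot R → ℂ) → Message L) : ℝ :=
  (∑ l : Message L, (sampleLaw R).real
      {ω | dec (destFading ω) (destReceived P₁ P₂ M (sourceVector L u l) ω) ≠ l}) /
    (Fintype.card (Message L) : ℝ)

/-- An error probability `p`, as a function of the total power `P`, has diversity order `d` if
`- log p(P) / log P` tends to `d` as `P → ∞`. -/
def HasDiversityOrder (p : ℝ → ℝ) (d : ℝ) : Prop :=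
  (∀ᶠ P in atTop, 0 < p P) ∧
    Tendsto (fun P => -Real.log (p P) / Real.log P) atTop (𝓝 d)

/-- The power `P₁ = α P` of the source when it gets the share `α` of the total power. -/
def sourcePower (α P : ℝ) : ℝ := α * P

/-- The power `P₂ = (1 - α) P / R` of each relay, so that `P₁ + R P₂ = P`. -/
def relayPower (R : ℕ) (α P : ℝ) : ℝ := (1 - α) * P / R

end RelayNetwork

end

open RelayNetwork

/-! Put v = M(g f), where g f is the vector of the products g_j f_j. Slots i and R + i both receive
the coordinate v_i, with amplitude √(P₁P₂/(P₁+1)) of order √P, multiplied by two unit phases which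
depend on the message. Thus the message l places a line of ℂ² in each block i, and the unknown
fadings only move a point along it. The lines of l and l' in block i agree iff a 2×2 determinant of
phases vanishes, which is the integrality condition (`phase_mul_eq_iff`). Up to a nonzero factor,
det [S_l S_l'] is the product of these R determinants, whence the determinant criterion.

Upper bound for the error. All covariances have the same determinant, so maximum likelihood compares
yᴴ Σ⁻¹ y, the value of a regularized least-squares problem (`exists_quadForm_eq`). An error
therefore provides fadings with which a wrong l' explains y almost as well as l does. If all lines
differ, elimination in each block forces every v_i, hence every g_j f_j, down to P^(-1/2) up to a
small power of P (`exists_norm_fading_le`). Each of the R independent products does so with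
probability about 1/P, and samples of norm above P^ε are rarer than any power of P.

Lower bound for the error. Let the lines of l and l' agree outside a set N of blocks. Rotating the
blocks of M(g f) aligns l' with l outside N; the mismatch inside N is at noise level when |v_i|² ≤
1/P there, and is absorbed by the destination noise. This change of variables, `swapMap`, preserves
a reference measure, g and the received vector, so any decoder errs for l or for l' on a set of
measure of order P^(-|N|) (`exists_mul_le_error_add_error`). Taking N to be all blocks matches the
upper bound; if two lines agree in one block, N can omit it, and order R is impossible. -/

noncomputable section

open scoped ComplexOrder

namespace RelayNetwork

section Code

/-! ### Algebra of the code -/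

/-- The diagonal entry of `D^l` in the coordinate `t`. -/
def phase {R K : ℕ} (L : Fin K → ℕ) (u : Slot R → Fin K → ℕ) (l : Message L) (t : Slot R) : ℂ :=
  ∏ ν, Complex.exp (2 * Real.pi * Complex.I * (u t ν : ℂ) / (L ν : ℂ)) ^ ((l ν : ℕ) + 1)

lemma prod_ofFn_diagonal {n : Type*} [Fintype n] [DecidableEq n] {K : ℕ} (d : Fin K → n → ℂ) :
    (List.ofFn fun ν => Matrix.diagonal (d ν)).prod = Matrix.diagonal (∏ ν, d ν) := by
  have h := map_list_prod (Matrix.diagonalRingHom n ℂ) (List.ofFn d)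
  rw [List.prod_ofFn, List.map_ofFn] at h
  exact h.symm

variable {R K : ℕ} {L : Fin K → ℕ} {u : Slot R → Fin K → ℕ}

lemma groupElement_eq (l : Message L) :
    groupElement L u l = Matrix.diagonal (phase L u l) := by
  have h : ∀ ν, generator L u ν ^ ((l ν : ℕ) + 1) = Matrix.diagonal
      ((fun t => Complex.exp (2 * Real.pi * Complex.I * (u t ν : ℂ) / (L ν : ℂ))) ^
        ((l ν : ℕ) + 1)) := fun ν => Matrix.diagonal_pow _ _
  simp only [groupElement, h]
  rw [prod_ofFn_diagonal]
  congr 1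
  ext t
  simp [phase]

lemma phase_eq_exp (l : Message L) (t : Slot R) :
    phase L u l t = Complex.exp (2 * Real.pi * Complex.I *
      ((∑ ν, (((l ν : ℕ) : ℝ) + 1) * (u t ν : ℝ) / (L ν : ℝ) : ℝ) : ℂ)) := by
  simp only [phase, ← Complex.exp_nat_mul, ← Complex.exp_sum]
  congr 1
  push_cast
  rw [Finset.mul_sum]
  refine Finset.sum_congr rfl fun ν _ => ?_
  ring

lemma norm_phase (l : Message L) (t : Slot R) : ‖phase L u l t‖ = 1 := by
  rw [phase_eq_exp, Complex.norm_exp]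
  simp

lemma phase_ne_zero (l : Message L) (t : Slot R) : phase L u l t ≠ 0 := by
  rw [← norm_ne_zero_iff, norm_phase]; norm_num

/-- The two lines spanned by the codewords in the block `i` agree iff the phase condition of the
theorem fails there. -/
lemma phase_mul_eq_iff (i : Fin R) (l l' : Message L) :
    phase L u l (Sum.inl i) * phase L u l' (Sum.inr i) =
        phase L u l (Sum.inr i) * phase L u l' (Sum.inl i) ↔
      ∃ z : ℤ, ∑ ν, (((l ν : ℕ) : ℝ) - ((l' ν : ℕ) : ℝ)) *
          ((u (Sum.inl i) ν : ℝ) - (u (Sum.inr i) ν : ℝ)) / (L ν : ℝ) = (z : ℝ) := by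
  simp only [phase_eq_exp, ← Complex.exp_add, Complex.exp_eq_exp_iff_exists_int]
  refine exists_congr fun z => ?_
  set a := ∑ ν, (((l ν : ℕ) : ℝ) + 1) * (u (Sum.inl i) ν : ℝ) / (L ν : ℝ) with ha
  set b := ∑ ν, (((l' ν : ℕ) : ℝ) + 1) * (u (Sum.inr i) ν : ℝ) / (L ν : ℝ) with hb
  set c := ∑ ν, (((l ν : ℕ) : ℝ) + 1) * (u (Sum.inr i) ν : ℝ) / (L ν : ℝ) with hc
  set d := ∑ ν, (((l' ν : ℕ) : ℝ) + 1) * (u (Sum.inl i) ν : ℝ) / (L ν : ℝ) with hd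
  -- The offset 1 between l_ν and its stored value cancels in the difference of the two messages.
  have h : ∑ ν, (((l ν : ℕ) : ℝ) - ((l' ν : ℕ) : ℝ)) *
      ((u (Sum.inl i) ν : ℝ) - (u (Sum.inr i) ν : ℝ)) / (L ν : ℝ) = a + b - c - d := by
    rw [ha, hb, hc, hd, ← Finset.sum_add_distrib, ← Finset.sum_sub_distrib,
      ← Finset.sum_sub_distrib]
    refine Finset.sum_congr rfl fun ν _ => ?_
    ring
  rw [h]
  have h2 : (2 * Real.pi * Complex.I : ℂ) ≠ 0 := Complex.two_pi_I_ne_zero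
  constructor
  · intro h
    have h3 : (2 * Real.pi * Complex.I : ℂ) * (a + b - c - d) = 2 * Real.pi * Complex.I * z := by
      linear_combination h
    have := mul_left_cancel₀ h2 h3
    exact_mod_cast this
  · intro h
    have : (a + b - c - d : ℂ) = z := by exact_mod_cast h
    linear_combination (2 * Real.pi * Complex.I : ℂ) * this

lemma sourceVector_apply (l : Message L) (t : Slot R) :
    sourceVector L u l t = phase L u l t / (Real.sqrt (2 * R) : ℂ) := by
  simp [sourceVector, groupElement_eq, Matrix.mulVec_diagonal, xVector, div_eq_mul_inv]

variable {M : Matrix (Fin R) (Fin R) ℂ}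

lemma relayMatrix_mulVec (j : Fin R) (x : Slot R → ℂ) (t : Slot R) :
    (relayMatrix M j).mulVec x t = gammaMatrix M t j * x t := by
  simp [relayMatrix, Matrix.mulVec_diagonal]

lemma codeword_apply (l : Message L) (t : Slot R) (j : Fin R) :
    codeword L u M l t j =
      phase L u l t * gammaMatrix M t j / (Real.sqrt (2 * R) : ℂ) := by
  simp only [codeword, Matrix.of_apply, relayMatrix_mulVec, sourceVector_apply]
  ring

lemma IsGBH.norm_entry (hM : IsGBH M) (i j : Fin R) : ‖M i j‖ = 1 := by
  have h := hM.entry_mul_conj i j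
  have h2 : ‖M i j‖ * ‖M i j‖ = 1 := by simpa using congrArg norm h
  nlinarith [norm_nonneg (M i j)]

lemma IsGBH.norm_gammaMatrix (hM : IsGBH M) (t : Slot R) (j : Fin R) :
    ‖gammaMatrix M t j‖ = 1 := by
  rcases t with i | i <;> simp [gammaMatrix, hM.norm_entry]

lemma IsGBH.det_ne_zero (hR : 0 < R) (hM : IsGBH M) : M.det ≠ 0 := by
  intro h
  have h2 := congrArg Matrix.det hM.mul_conjTranspose
  rw [Matrix.det_mul, h, Matrix.det_smul, Matrix.det_one] at h2
  have : (R : ℂ) ≠ 0 := by exact_mod_cast hR.ne'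
  rw [mul_one, zero_mul, Fintype.card_fin] at h2
  exact pow_ne_zero R this h2.symm

lemma codeword_eq (l : Message L) :
    codeword L u M l = ((Real.sqrt (2 * R) : ℂ)⁻¹) •
      Matrix.fromRows (Matrix.diagonal (fun i => phase L u l (Sum.inl i)) * M)
        (Matrix.diagonal (fun i => phase L u l (Sum.inr i)) * M) := by
  ext t j
  rw [codeword_apply]
  rcases t with i | i <;>
    simp [gammaMatrix, Matrix.diagonal_mul, div_eq_mul_inv, mul_comm, mul_left_comm]

/-- The juxtaposition is square. It factors as a scalar times a block matrix of four diagonals times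
diag(M, M), and the determinant of the diagonals is the product over i of the 2×2 determinants of
phases. -/
lemma det_fromCols_codeword_ne_zero_iff (hR : 0 < R) (hM : IsGBH M) (l l' : Message L) :
    ((Matrix.fromCols (codeword L u M l) (codeword L u M l')).conjTranspose *
      Matrix.fromCols (codeword L u M l) (codeword L u M l')).det ≠ 0 ↔
    ∀ i, phase L u l (Sum.inl i) * phase L u l' (Sum.inr i) ≠
      phase L u l (Sum.inr i) * phase L u l' (Sum.inl i) := by
  set p : Message L → Fin R → ℂ := fun l i => phase L u l (Sum.inl i) with hp
  set q : Message L → Fin R → ℂ := fun l i => phase L u l (Sum.inr i) with hq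
  set c : ℂ := (Real.sqrt (2 * R) : ℂ)⁻¹ with hc
  have hc0 : c ≠ 0 := by
    have : Real.sqrt (2 * R) ≠ 0 := by positivity
    simpa [hc] using this
  have hX : Matrix.fromCols (codeword L u M l) (codeword L u M l') =
      c • (Matrix.fromBlocks (Matrix.diagonal (p l)) (Matrix.diagonal (p l'))
        (Matrix.diagonal (q l)) (Matrix.diagonal (q l')) *
        Matrix.fromBlocks M 0 0 M) := by
    rw [codeword_eq, codeword_eq, Matrix.fromBlocks_multiply]
    ext s t
    rcases s with s | s <;> rcases t with t | t <;> simp [hp, hq, hc]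
  have hdet : (Matrix.fromBlocks (Matrix.diagonal (p l)) (Matrix.diagonal (p l'))
      (Matrix.diagonal (q l)) (Matrix.diagonal (q l'))).det =
      ∏ i, (p l i * q l' i - q l i * p l' i) := by
    have hu : IsUnit (Matrix.diagonal (p l)) := by
      rw [Matrix.isUnit_iff_isUnit_det, Matrix.det_diagonal, isUnit_iff_ne_zero]
      exact Finset.prod_ne_zero_iff.2 fun i _ => phase_ne_zero _ _
    have := hu.invertible
    have hi : ⅟(Matrix.diagonal (p l)) = Matrix.diagonal (fun i => (p l i)⁻¹) := by
      refine invOf_eq_right_inv ?_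
      rw [Matrix.diagonal_mul_diagonal, ← Matrix.diagonal_one]
      congr 1
      ext i
      exact mul_inv_cancel₀ (phase_ne_zero _ _)
    rw [Matrix.det_fromBlocks₁₁, hi]
    simp only [Matrix.diagonal_mul_diagonal, Matrix.diagonal_sub, Matrix.det_diagonal]
    rw [← Finset.prod_mul_distrib]
    refine Finset.prod_congr rfl fun i _ => ?_
    have : p l i ≠ 0 := phase_ne_zero _ _
    field_simp
  rw [Matrix.det_mul, Matrix.det_conjTranspose, mul_ne_zero_iff, star_ne_zero, and_self, hX,
    Matrix.det_smul, Matrix.det_mul, Matrix.det_fromBlocks_zero₁₂, hdet]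
  have hd := hM.det_ne_zero hR
  simp only [ne_eq, mul_eq_zero, pow_eq_zero_iff', hc0, false_and, hd, or_self, or_false,
    false_or, Finset.prod_eq_zero_iff, not_exists, Finset.mem_univ, true_and, sub_eq_zero]
  rfl

end Code

section Gaussian

/-! ### The Gaussian law -/

instance : IsProbabilityMeasure cscg := by
  unfold cscg
  refine Measure.isProbabilityMeasure_map ?_
  exact (Complex.measurableEquivRealProd.symm.measurable).aemeasurable

lemma cscg_eq_withDensity :
    cscg = volume.withDensity fun z : ℂ => ENNReal.ofReal (Real.pi⁻¹ * Real.exp (-‖z‖ ^ 2)) := by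
  have hv : (1 / 2 : NNReal) ≠ 0 := by norm_num
  have h1 : ((gaussianReal 0 (1 / 2)).prod (gaussianReal 0 (1 / 2))) =
      volume.withDensity fun z : ℝ × ℝ => gaussianPDF 0 (1 / 2) z.1 * gaussianPDF 0 (1 / 2) z.2 := by
    rw [gaussianReal_of_var_ne_zero _ hv,
      prod_withDensity (measurable_gaussianPDF _ _) (measurable_gaussianPDF _ _)]
    rfl
  have hm : Measurable fun p : ℝ × ℝ => (⟨p.1, p.2⟩ : ℂ) :=
    Complex.measurableEquivRealProd.symm.measurable
  ext s hs
  have hs' := Complex.volume_preserving_equiv_real_prod.symm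
  rw [cscg, h1, Measure.map_apply hm hs, withDensity_apply _ (hm hs), withDensity_apply _ hs]
  rw [← hs'.setLIntegral_comp_preimage_emb Complex.measurableEquivRealProd.symm.measurableEmbedding]
  refine setLIntegral_congr_fun (hm hs) fun z _ => ?_
  obtain ⟨a, b⟩ := z
  have hn : ‖Complex.measurableEquivRealProd.symm (a, b)‖ ^ 2 = a ^ 2 + b ^ 2 := by
    rw [Complex.sq_norm, Complex.normSq_apply]
    change a * a + b * b = _
    ring
  simp only [hn, gaussianPDF, gaussianPDFReal]
  rw [← ENNReal.ofReal_mul (by positivity)]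
  congr 1
  have h2 : (2 * Real.pi * ((1 / 2 : NNReal) : ℝ)) = Real.pi := by push_cast; ring
  have h3 : (2 * ((1 / 2 : NNReal) : ℝ)) = 1 := by push_cast; ring
  rw [h2, h3]
  have h4 : (Real.sqrt Real.pi)⁻¹ * (Real.sqrt Real.pi)⁻¹ = Real.pi⁻¹ := by
    rw [← mul_inv, Real.mul_self_sqrt Real.pi_pos.le]
  rw [mul_mul_mul_comm, h4, ← Real.exp_add]
  congr 2
  ring

/-- On every disc the Gaussian law dominates a multiple of Lebesgue measure. -/
lemma exists_smul_restrict_le_cscg (r : ℝ) :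
    ∃ c : ENNReal, c ≠ 0 ∧ c ≠ ⊤ ∧ c • (volume.restrict (Metric.closedBall (0 : ℂ) r)) ≤ cscg := by
  refine ⟨ENNReal.ofReal (Real.pi⁻¹ * Real.exp (-r ^ 2)), ?_, ENNReal.ofReal_ne_top, ?_⟩
  · rw [ne_eq, ENNReal.ofReal_eq_zero, not_le]
    positivity
  · refine Measure.le_iff.2 fun s hs => ?_
    have hB : MeasurableSet (Metric.closedBall (0 : ℂ) r) := Metric.isClosed_closedBall.measurableSet
    rw [Measure.smul_apply, cscg_eq_withDensity, withDensity_apply _ hs,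
      Measure.restrict_apply hs, smul_eq_mul, ← setLIntegral_const]
    refine (setLIntegral_mono' (hs.inter hB) fun z hz => ?_).trans
      (lintegral_mono_set Set.inter_subset_left)
    have hz' : ‖z‖ ≤ r := by simpa using hz.2
    refine ENNReal.ofReal_le_ofReal ?_
    gcongr

/-- Domination passes to products: the product measure comes from the largest outer measure bounded
on boxes by the product of the factors, so boxes suffice. -/
lemma smul_restrict_pi_le {ι : Type*} [Fintype ι] {c : ENNReal} {A : Set ℂ}
    (h : c • (volume.restrict A) ≤ cscg) :
    (c ^ Fintype.card ι) • ((volume : Measure (ι → ℂ)).restrict (Set.univ.pi fun _ => A)) ≤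
      Measure.pi fun _ : ι => cscg := by
  refine Measure.le_iff.2 fun s hs => ?_
  rw [Measure.pi, toMeasure_apply _ _ hs]
  suffices hle : ((c ^ Fintype.card ι) •
      ((volume : Measure (ι → ℂ)).restrict (Set.univ.pi fun _ => A))).toOuterMeasure ≤
      OuterMeasure.pi fun _ : ι => cscg.toOuterMeasure from hle s
  refine OuterMeasure.le_pi.2 fun t _ => ?_
  have h1 : ∏ i, (c • (volume.restrict A)) (t i) ≤ ∏ i, cscg (t i) :=
    Finset.prod_le_prod' fun i _ => h (t i)
  refine le_trans (le_of_eq ?_) h1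
  rw [volume_pi, Measure.restrict_pi_pi]
  simp [Measure.pi_pi, Finset.prod_mul_distrib]

/-- In the real dimension two, ‖z‖^(-s) is integrable at the origin exactly for s < 2. The excluded
endpoint is the source of the loss P^δ in the upper bound. -/
lemma lintegral_cscg_rpow_lt_top {s : ℝ} (hs : s < 2) :
    ∫⁻ z, ENNReal.ofReal (‖z‖ ^ (-s)) ∂cscg < ⊤ := by
  have hint : Integrable fun x : ℂ => ‖x‖ ^ (-s) * Real.exp (-‖x‖ ^ (2 : ℝ)) := by
    -- A non-integrable function has integral 0 by convention, which contradicts the positive Gamma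
    -- value of this integral.
    by_contra h
    have h2 := Complex.integral_rpow_mul_exp_neg_rpow (p := 2) (q := -s) (by norm_num)
      (by linarith)
    rw [integral_undef h] at h2
    have : 0 < Real.Gamma ((-s + 2) / 2) := Real.Gamma_pos_of_pos (by linarith)
    have : 0 < 2 * Real.pi / 2 * Real.Gamma ((-s + 2) / 2) := by positivity
    linarith
  rw [cscg_eq_withDensity, lintegral_withDensity_eq_lintegral_mul _ (by fun_prop) (by fun_prop)]
  refine lt_of_le_of_lt (lintegral_mono fun z => ?_) hint.lintegral_lt_top
  simp only [Pi.mul_apply]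
  rw [← ENNReal.ofReal_mul (by positivity)]
  refine ENNReal.ofReal_le_ofReal ?_
  have : Real.pi⁻¹ ≤ 1 := inv_le_one_of_one_le₀ (by linarith [Real.pi_gt_three])
  have h0 : 0 ≤ ‖z‖ ^ (-s) := by positivity
  have h1 := Real.exp_pos (-‖z‖ ^ 2)
  rw [Real.rpow_two]
  calc Real.pi⁻¹ * Real.exp (-‖z‖ ^ 2) * ‖z‖ ^ (-s) ≤ 1 * Real.exp (-‖z‖ ^ 2) * ‖z‖ ^ (-s) := by
        gcongr
    _ = _ := by ring

/-- Markov's inequality; the added 1 only makes the constant positive. -/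
lemma measure_le_ofReal_lintegral_mul_inv {α : Type*} [MeasurableSpace α] {μ : Measure α} {A : Set α}
    {φ : α → ENNReal} {a : ℝ} (ha : 0 < a) (hφ : Measurable φ) (hA : ∀ x ∈ A, ENNReal.ofReal a ≤ φ x)
    (hfin : ∫⁻ x, φ x ∂μ < ⊤) : μ A ≤ ENNReal.ofReal (((∫⁻ x, φ x ∂μ).toReal + 1) * a⁻¹) := by
  have h := mul_meas_ge_le_lintegral (μ := μ) hφ (ENNReal.ofReal a)
  have ha' : ENNReal.ofReal a ≠ 0 := by simpa using ha
  calc μ A ≤ μ {x | ENNReal.ofReal a ≤ φ x} := measure_mono hA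
    _ ≤ (∫⁻ x, φ x ∂μ) / ENNReal.ofReal a := by
        rw [ENNReal.le_div_iff_mul_le (Or.inl ha') (Or.inl ENNReal.ofReal_ne_top), mul_comm]
        exact h
    _ ≤ _ := by
        rw [ENNReal.ofReal_mul (by positivity), ENNReal.ofReal_inv_of_pos ha, div_eq_mul_inv]
        gcongr
        exact ENNReal.le_ofReal_iff_toReal_le hfin.ne (by positivity) |>.2 (by linarith)

/-- Small-ball estimate for a product of two independent Gaussian variables. -/
lemma exists_cscg_prod_le {s : ℝ} (hs0 : 0 < s) (hs : s < 2) :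
    ∃ C : ℝ, 0 < C ∧ ∀ δ : ℝ, 0 < δ →
      (cscg.prod cscg) {p : ℂ × ℂ | ‖p.2 * p.1‖ ≤ δ} ≤ ENNReal.ofReal (C * δ ^ s) := by
  -- Markov's inequality is applied to ‖x‖^(-s) ‖y‖^(-s). The value ⊤ at 0 is imposed because the
  -- real power `0 ^ (-s)` is 0, while the event contains the points with x = 0 or y = 0.
  set φ : ℂ → ENNReal := fun z => if z = 0 then ⊤ else ENNReal.ofReal (‖z‖ ^ (-s)) with hφ
  have hφm : Measurable φ :=
    Measurable.ite (measurableSet_singleton 0) measurable_const (by fun_prop)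
  have hφi : ∫⁻ z, φ z ∂cscg < ⊤ := by
    refine lt_of_eq_of_lt (lintegral_congr_ae ?_) (lintegral_cscg_rpow_lt_top hs)
    have h0 : ∀ᵐ z ∂cscg, z ≠ 0 := by
      rw [cscg_eq_withDensity]
      refine (withDensity_absolutelyContinuous _ _).ae_le ?_
      exact Measure.ae_ne volume 0
    filter_upwards [h0] with z hz
    simp [hφ, hz]
  set Φ : ℂ × ℂ → ENNReal := fun p => φ p.1 * φ p.2 with hΦ
  have hΦm : Measurable Φ := (hφm.comp measurable_fst).mul (hφm.comp measurable_snd)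
  have hΦi : ∫⁻ p, Φ p ∂(cscg.prod cscg) < ⊤ := by
    rw [hΦ, lintegral_prod_mul hφm.aemeasurable hφm.aemeasurable]
    exact ENNReal.mul_lt_top hφi hφi
  refine ⟨(∫⁻ p, Φ p ∂(cscg.prod cscg)).toReal + 1, by positivity, fun δ hδ => ?_⟩
  have := measure_le_ofReal_lintegral_mul_inv (μ := cscg.prod cscg)
    (A := {p : ℂ × ℂ | ‖p.2 * p.1‖ ≤ δ}) (a := δ ^ (-s)) (by positivity) hΦm ?_ hΦi
  · rwa [Real.rpow_neg hδ.le, inv_inv] at this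
  · rintro ⟨x, y⟩ hxy
    have hφ0 : ∀ z, φ z ≠ 0 := by
      intro z
      simp only [hφ]
      split_ifs with h
      · simp
      · have : 0 < ‖z‖ := norm_pos_iff.2 h
        have : 0 < ‖z‖ ^ (-s) := by positivity
        simpa using this
    simp only [hΦ]
    by_cases hx : x = 0
    · have : φ x = ⊤ := by simp [hφ, hx]
      rw [this, ENNReal.top_mul (hφ0 y)]
      exact le_top
    by_cases hy : y = 0
    · have : φ y = ⊤ := by simp [hφ, hy]
      rw [this, ENNReal.mul_top (hφ0 x)]
      exact le_top
    simp only [hφ, hx, hy, if_false]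
    rw [← ENNReal.ofReal_mul (by positivity), ← Real.mul_rpow (norm_nonneg _) (norm_nonneg _)]
    refine ENNReal.ofReal_le_ofReal ?_
    have hpos : 0 < ‖x‖ * ‖y‖ := mul_pos (norm_pos_iff.2 hx) (norm_pos_iff.2 hy)
    refine Real.rpow_le_rpow_of_nonpos hpos ?_ (by linarith)
    simpa [mul_comm] using hxy

/-- The pairs (f_j, g_j) are independent and identically distributed, so regrouping by j turns the
event into a box. -/
lemma measure_prod_small_eq {ι : Type*} [Fintype ι] (δ : ℝ) :
    ((Measure.pi fun _ : ι => cscg).prod (Measure.pi fun _ : ι => cscg))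
      {p | ∀ j, ‖p.2 j * p.1 j‖ ≤ δ} =
    ((cscg.prod cscg) {p : ℂ × ℂ | ‖p.2 * p.1‖ ≤ δ}) ^ Fintype.card ι := by
  have h := measurePreserving_arrowProdEquivProdArrow ℂ ℂ ι (fun _ => cscg) (fun _ => cscg)
  rw [← h.measure_preimage_equiv]
  have : (MeasurableEquiv.arrowProdEquivProdArrow ℂ ℂ ι) ⁻¹' {p | ∀ j, ‖p.2 j * p.1 j‖ ≤ δ} =
      Set.univ.pi fun _ : ι => {p : ℂ × ℂ | ‖p.2 * p.1‖ ≤ δ} := by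
    ext p
    simp [MeasurableEquiv.arrowProdEquivProdArrow, Equiv.arrowProdEquivProdArrow]
  rw [this, Measure.pi_pi]
  simp

instance (R : ℕ) : IsProbabilityMeasure (sampleLaw R) := by
  unfold sampleLaw; infer_instance

instance : IsGaussian cscg :=
  isGaussian_map_equiv (μ := (gaussianReal 0 (1 / 2)).prod (gaussianReal 0 (1 / 2)))
    Complex.equivRealProdCLM.symm

/-! ### Tails of the sample law -/

/-- The norm has tails which decrease faster than any power. -/
def HasFastTails {E : Type*} [Norm E] [MeasurableSpace E] (μ : Measure E) : Prop :=
  ∀ k : ℕ, ∃ C : ℝ, 0 < C ∧ ∀ X : ℝ, 0 < X →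
    μ {x | X < ‖x‖} ≤ ENNReal.ofReal (C * (X ^ k)⁻¹)

lemma hasFastTails_cscg : HasFastTails cscg := by
  intro k
  have hfin : ∫⁻ z, ENNReal.ofReal (‖z‖ ^ k) ∂cscg < ⊤ :=
    ((IsGaussian.memLp_id cscg k (ENNReal.natCast_ne_top k)).integrable_norm_pow'
      ).lintegral_lt_top
  refine ⟨_, ?_, fun X hX => measure_le_ofReal_lintegral_mul_inv (pow_pos hX k) (by fun_prop) ?_ hfin⟩
  · positivity
  · intro z hz
    have : X ≤ ‖z‖ := le_of_lt hz
    exact ENNReal.ofReal_le_ofReal (by gcongr)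

lemma HasFastTails.prod {E F : Type*} [SeminormedAddCommGroup E] [SeminormedAddCommGroup F]
    [MeasurableSpace E] [MeasurableSpace F] {μ : Measure E} {ν : Measure F}
    [IsProbabilityMeasure μ] [IsProbabilityMeasure ν] (hμ : HasFastTails μ)
    (hν : HasFastTails ν) : HasFastTails (μ.prod ν) := by
  intro k
  obtain ⟨C, hC, h⟩ := hμ k
  obtain ⟨D, hD, h'⟩ := hν k
  refine ⟨C + D, by positivity, fun X hX => ?_⟩
  have hsub : {p : E × F | X < ‖p‖} ⊆
      ({x | X < ‖x‖} ×ˢ Set.univ) ∪ (Set.univ ×ˢ {y | X < ‖y‖}) := by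
    rintro ⟨x, y⟩ hp
    simpa [Prod.norm_def] using hp
  calc (μ.prod ν) {p : E × F | X < ‖p‖} ≤ _ := measure_mono hsub
    _ ≤ _ := measure_union_le _ _
    _ ≤ ENNReal.ofReal (C * (X ^ k)⁻¹) + ENNReal.ofReal (D * (X ^ k)⁻¹) := by
        simp only [Measure.prod_prod, measure_univ, mul_one, one_mul]
        exact add_le_add (h X hX) (h' X hX)
    _ = _ := by rw [← ENNReal.ofReal_add (by positivity) (by positivity), add_mul]

lemma HasFastTails.pi {ι E : Type*} [Fintype ι] [SeminormedAddCommGroup E] [MeasurableSpace E]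
    {μ : Measure E} [IsProbabilityMeasure μ] (hμ : HasFastTails μ) :
    HasFastTails (Measure.pi fun _ : ι => μ) := by
  intro k
  obtain ⟨C, hC, h⟩ := hμ k
  refine ⟨Fintype.card ι * C + 1, by positivity, fun X hX => ?_⟩
  have hsub : {p : ι → E | X < ‖p‖} ⊆ ⋃ i, Function.eval i ⁻¹' {x | X < ‖x‖} := by
    intro p hp
    by_contra hcon
    have h2 : ∀ i, ‖p i‖ ≤ X := by simpa using hcon
    exact absurd ((pi_norm_le_iff_of_nonneg hX.le).2 h2) (not_le.2 hp)
  calc (Measure.pi fun _ : ι => μ) {p : ι → E | X < ‖p‖} ≤ _ := measure_mono hsub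
    _ ≤ ∑ i, (Measure.pi fun _ : ι => μ) (Function.eval i ⁻¹' {x | X < ‖x‖}) :=
        measure_iUnion_fintype_le _ _
    _ ≤ ∑ _i : ι, ENNReal.ofReal (C * (X ^ k)⁻¹) := by
        refine Finset.sum_le_sum fun i _ => ?_
        classical
        rw [Set.eval_preimage, Measure.pi_pi,
          Finset.prod_eq_single i (by intro j _ hj; simp [hj]) (by simp)]
        simpa using h X hX
    _ = ENNReal.ofReal (Fintype.card ι * (C * (X ^ k)⁻¹)) := by
        rw [Finset.sum_const, nsmul_eq_mul, Finset.card_univ,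
          ENNReal.ofReal_mul (Nat.cast_nonneg _), ENNReal.ofReal_natCast]
    _ ≤ _ := by
        refine ENNReal.ofReal_le_ofReal ?_
        rw [← mul_assoc]
        gcongr
        linarith

lemma hasFastTails_sampleLaw (R : ℕ) : HasFastTails (sampleLaw R) :=
  hasFastTails_cscg.pi.prod (hasFastTails_cscg.pi.prod
    (hasFastTails_cscg.pi.pi.prod hasFastTails_cscg.pi))

end Gaussian

section Receiver

/-! ### Quadratic forms of regularized covariance matrices -/

section Quadratic
open Matrix

variable {m n : Type*} [Fintype m] [Fintype n]

lemma re_dotProduct_star_self (x : n → ℂ) : (star x ⬝ᵥ x).re = ∑ i, ‖x i‖ ^ 2 := by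
  simp only [dotProduct, Complex.re_sum]
  refine Finset.sum_congr rfl fun i _ => ?_
  rw [Complex.sq_norm, Complex.normSq_apply]
  simp

lemma re_dotProduct_star_comm (x y : n → ℂ) : (star x ⬝ᵥ y).re = (star y ⬝ᵥ x).re := by
  have h : star (star x ⬝ᵥ y) = star y ⬝ᵥ x := by rw [star_dotProduct, star_star, dotProduct_comm]
  rw [← h]
  simp

lemma sum_norm_sq_add (x y : n → ℂ) :
    ∑ i, ‖x i + y i‖ ^ 2 = ∑ i, ‖x i‖ ^ 2 + 2 * (star x ⬝ᵥ y).re + ∑ i, ‖y i‖ ^ 2 := by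
  have h := re_dotProduct_star_self (x + y)
  simp only [Pi.add_apply] at h
  rw [← h, star_add, add_dotProduct, dotProduct_add, dotProduct_add]
  simp only [Complex.add_re]
  rw [re_dotProduct_star_self, re_dotProduct_star_self, re_dotProduct_star_comm y x]
  ring

lemma star_mulVec_dotProduct (B : Matrix m n ℂ) (x : n → ℂ) (z : m → ℂ) :
    star (B *ᵥ x) ⬝ᵥ z = star x ⬝ᵥ (Bᴴ *ᵥ z) := by
  rw [star_mulVec, dotProduct_mulVec]

variable [DecidableEq m]

/-- The covariance matrix `B Bᴴ + γ I`. -/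
def regCov (B : Matrix m n ℂ) (γ : ℝ) : Matrix m m ℂ := B * Bᴴ + (γ : ℂ) • 1

lemma regCov_posDef (B : Matrix m n ℂ) {γ : ℝ} (hγ : 0 < γ) : (regCov B γ).PosDef :=
  PosDef.posSemidef_add (posSemidef_self_mul_conjTranspose B)
    (PosDef.one.smul (by exact_mod_cast hγ))

/-- The quadratic form of the inverse covariance is the value of a least-squares problem. -/
lemma exists_quadForm_eq (B : Matrix m n ℂ) {γ : ℝ} (hγ : 0 < γ) (y : m → ℂ) :
    ∃ f₀ : n → ℂ, (star y ⬝ᵥ ((regCov B γ)⁻¹ *ᵥ y)).re =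
        ∑ j, ‖f₀ j‖ ^ 2 + (∑ t, ‖(y - B *ᵥ f₀) t‖ ^ 2) / γ ∧
      ∀ f, (star y ⬝ᵥ ((regCov B γ)⁻¹ *ᵥ y)).re ≤
        ∑ j, ‖f j‖ ^ 2 + (∑ t, ‖(y - B *ᵥ f) t‖ ^ 2) / γ := by
  have hu : IsUnit (regCov B γ).det := (regCov_posDef B hγ).det_pos.ne'.isUnit
  set z := (regCov B γ)⁻¹ *ᵥ y with hz
  have hy : y = B *ᵥ (Bᴴ *ᵥ z) + (γ : ℂ) • z := by
    have : regCov B γ *ᵥ z = y := by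
      rw [hz, mulVec_mulVec, mul_nonsing_inv _ hu, one_mulVec]
    rw [mulVec_mulVec, ← this]
    nth_rewrite 1 [regCov]
    rw [add_mulVec, smul_mulVec, one_mulVec]
  -- The minimizer is Bᴴ Σ⁻¹ y, and its residual y - B f₀ is γ z.
  set f₀ := Bᴴ *ᵥ z with hf₀
  have hr : ∀ x, ∑ t, ‖((γ : ℂ) • z + x) t‖ ^ 2 =
      γ ^ 2 * ∑ t, ‖z t‖ ^ 2 + 2 * γ * (star z ⬝ᵥ x).re + ∑ t, ‖x t‖ ^ 2 := by
    intro x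
    have h1 := sum_norm_sq_add ((γ : ℂ) • z) x
    have h2 : (star ((γ : ℂ) • z) ⬝ᵥ x).re = γ * (star z ⬝ᵥ x).re := by
      rw [star_smul, smul_dotProduct]
      simp
    have h3 : ∑ t, ‖((γ : ℂ) • z) t‖ ^ 2 = γ ^ 2 * ∑ t, ‖z t‖ ^ 2 := by
      rw [Finset.mul_sum]
      refine Finset.sum_congr rfl fun t _ => ?_
      simp [mul_pow]
    simp only [Pi.add_apply] at h1 ⊢
    rw [h1, h2, h3]
    ring
  have hq : (star y ⬝ᵥ z).re = ∑ j, ‖f₀ j‖ ^ 2 + γ * ∑ t, ‖z t‖ ^ 2 := by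
    rw [re_dotProduct_star_comm, hy, dotProduct_add, dotProduct_smul, Complex.add_re,
      ← re_dotProduct_star_self z, re_dotProduct_star_comm z, star_mulVec_dotProduct,
      re_dotProduct_star_self]
    simp
  refine ⟨f₀, ?_, fun f => ?_⟩
  · have h1 := hr 0
    simp only [dotProduct_zero, add_zero, Complex.zero_re, mul_zero, Pi.zero_apply, norm_zero] at h1
    have h2 : y - B *ᵥ f₀ = (γ : ℂ) • z := by rw [hy]; simp
    rw [hq, h2, h1]
    field_simp
    simp
    ring
  -- Expanding around f₀, the cross terms cancel by `h4`, and the excess ‖d‖² + ‖B d‖²/γ is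
  -- nonnegative.
  · set d := f - f₀ with hd
    have h2 : y - B *ᵥ f = (γ : ℂ) • z + -(B *ᵥ d) := by
      rw [hd, mulVec_sub]; nth_rewrite 1 [hy]; abel
    have h3 : ∑ j, ‖f j‖ ^ 2 = ∑ j, ‖f₀ j + d j‖ ^ 2 := by simp [hd]
    have h4 : (star f₀ ⬝ᵥ d).re = (star z ⬝ᵥ (B *ᵥ d)).re := by
      rw [hf₀, star_mulVec_dotProduct, conjTranspose_conjTranspose]
    rw [h3, sum_norm_sq_add, h2, hr, hq, h4, dotProduct_neg, Complex.neg_re]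
    have h5 : 0 ≤ ∑ j, ‖d j‖ ^ 2 := by positivity
    have h6 : 0 ≤ (∑ t, ‖(-(B *ᵥ d)) t‖ ^ 2) / γ := by positivity
    have h7 : ∀ a b c : ℝ, (γ ^ 2 * a + 2 * γ * b + c) / γ = γ * a + 2 * b + c / γ := by
      intro a b c; field_simp
    rw [h7]
    linarith

end Quadratic

/-! ### The received signal -/

/-- The row index of `M` used in the coordinate `t`. -/
def blockIndex {R : ℕ} : Slot R → Fin R := Sum.elim id id

/-- The amplitude with which the coordinates of `M (g f)` are received. -/
def gain (P₁ P₂ : ℝ) : ℝ := Real.sqrt (P₁ * P₂ / (P₁ + 1))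

/-- The total noise at the destination. -/
def noise {R : ℕ} (P₁ P₂ : ℝ) (M : Matrix (Fin R) (Fin R) ℂ) (ω : Sample R) : Slot R → ℂ :=
  fun t => (∑ j, ω.2.1 j * (Real.sqrt (P₂ / (1 + P₁)) * (gammaMatrix M t j * ω.2.2.1 j t))) +
    ω.2.2.2 t

/-- The variance of each coordinate of the noise, given the fadings `g`. -/
def noiseVar {R : ℕ} (P₁ P₂ : ℝ) (g : Fin R → ℂ) : ℝ := 1 + P₂ / (1 + P₁) * ∑ j, ‖g j‖ ^ 2

variable {R K : ℕ} {L : Fin K → ℕ} {u : Slot R → Fin K → ℕ} {M : Matrix (Fin R) (Fin R) ℂ}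
  {P₁ P₂ : ℝ}

lemma gammaMatrix_eq (t : Slot R) (j : Fin R) : gammaMatrix M t j = M (blockIndex t) j := by
  rcases t with i | i <;> rfl

variable (L u M P₁ P₂) in
/-- The matrix through which the fadings `f` are received, for the message `l`. -/
def channelMatrix (l : Message L) (g : Fin R → ℂ) : Matrix (Slot R) (Fin R) ℂ :=
  Matrix.of fun t j => gain P₁ P₂ * phase L u l t * (M (blockIndex t) j * g j)

lemma channelMatrix_mulVec (l : Message L) (g f : Fin R → ℂ) (t : Slot R) :
    (channelMatrix L u M P₁ P₂ l g).mulVec f t =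
      gain P₁ P₂ * phase L u l t * M.mulVec (g * f) (blockIndex t) := by
  simp only [Matrix.mulVec, dotProduct, channelMatrix, Matrix.of_apply, Finset.mul_sum]
  refine Finset.sum_congr rfl fun j _ => ?_
  simp only [Pi.mul_apply]
  ring

/-- The message enters only through the matrix applied to f; the noise is the same function of the
sample for all messages. -/
lemma destReceived_eq (hR : 0 < R) (hP₁ : 0 ≤ P₁) (hP₂ : 0 ≤ P₂) (l : Message L) (ω : Sample R) :
    destReceived P₁ P₂ M (sourceVector L u l) ω =
      (channelMatrix L u M P₁ P₂ l (destFading ω)).mulVec ω.1 + noise P₁ P₂ M ω := by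
  have h2R : (Real.sqrt (2 * R) : ℂ) ≠ 0 := by
    have : Real.sqrt (2 * R) ≠ 0 := by positivity
    exact_mod_cast this
  have hs : Real.sqrt (P₂ / (1 + P₁)) * Real.sqrt (P₁ * (2 * R)) =
      gain P₁ P₂ * Real.sqrt (2 * R) := by
    rw [gain, ← Real.sqrt_mul (by positivity), ← Real.sqrt_mul (by positivity), add_comm 1 P₁]
    congr 1
    ring
  have hs' : (Real.sqrt (P₂ / (1 + P₁)) : ℂ) * Real.sqrt (P₁ * (2 * R)) =
      gain P₁ P₂ * Real.sqrt (2 * R) := by exact_mod_cast hs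
  ext t
  simp only [destReceived, relayTransmitted, Pi.add_apply, Finset.sum_apply, Pi.smul_apply,
    smul_eq_mul, relayMatrix_mulVec, relayReceived, sourceVector_apply, noise]
  simp only [Matrix.mulVec, dotProduct, channelMatrix, Matrix.of_apply, destFading, ← add_assoc, ← Finset.sum_add_distrib,
    gammaMatrix_eq]
  congr 1
  refine Finset.sum_congr rfl fun j _ => ?_
  have h : (Real.sqrt (P₂ / (1 + P₁)) : ℂ) *
      (Real.sqrt (P₁ * (2 * R)) * ω.1 j * (phase L u l t / Real.sqrt (2 * R))) =
      gain P₁ P₂ * ω.1 j * phase L u l t := by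
    rw [← mul_assoc, ← mul_assoc, hs']
    field_simp
  linear_combination (ω.2.1 j * M (blockIndex t) j) * h

/-- The factor T = 2R in ρ cancels the normalization 1/√(2R) of the two codeword factors. -/
lemma receivedCov_eq (hR : 0 < R) (hP₁ : 0 ≤ P₁) (hP₂ : 0 ≤ P₂) (l : Message L) (g : Fin R → ℂ) :
    receivedCov P₁ P₂ (codeword L u M l) g =
      regCov (channelMatrix L u M P₁ P₂ l g) (noiseVar P₁ P₂ g) := by
  have h2R : (Real.sqrt (2 * R) : ℂ) * Real.sqrt (2 * R) = 2 * R := by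
    rw [← Complex.ofReal_mul, Real.mul_self_sqrt (by positivity)]; push_cast; ring
  have h2R0 : (Real.sqrt (2 * R) : ℂ) ≠ 0 := by
    have : Real.sqrt (2 * R) ≠ 0 := by positivity
    exact_mod_cast this
  have hgain : (gain P₁ P₂ : ℂ) * gain P₁ P₂ = P₁ * P₂ / (P₁ + 1) := by
    rw [← Complex.ofReal_mul, gain, Real.mul_self_sqrt (by positivity)]; push_cast; ring
  unfold receivedCov regCov noiseVar
  congr 1
  ext s t
  rw [Matrix.smul_apply, Matrix.mul_apply, Matrix.mul_apply]
  simp only [Matrix.mul_diagonal, Matrix.conjTranspose_apply,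
    codeword_apply, channelMatrix, Matrix.of_apply, gammaMatrix_eq, smul_eq_mul, Finset.mul_sum]
  refine Finset.sum_congr rfl fun j _ => ?_
  have hg : ((‖g j‖ ^ 2 : ℝ) : ℂ) = g j * star (g j) := by
    rw [← Complex.normSq_eq_norm_sq, Complex.normSq_eq_conj_mul_self]
    simp [mul_comm]
  rw [hg]
  simp only [star_mul', star_div₀, Complex.star_def, Complex.conj_ofReal]
  push_cast
  have h3 : (P₁ : ℂ) * P₂ * (2 * R) / (P₁ + 1) = gain P₁ P₂ * gain P₁ P₂ *
      (Real.sqrt (2 * R) * Real.sqrt (2 * R)) := by rw [hgain, h2R]; ring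
  rw [h3]
  field_simp

/-- The covariances are conjugate to one another by unitary diagonal matrices of phases. Hence the
likelihoods differ only in their exponents. -/
lemma det_regCov_channelMatrix (l l' : Message L) (g : Fin R → ℂ) (γ : ℝ) :
    (regCov (channelMatrix L u M P₁ P₂ l g) γ).det =
      (regCov (channelMatrix L u M P₁ P₂ l' g) γ).det := by
  set B : Matrix (Slot R) (Fin R) ℂ := Matrix.of fun t j => gain P₁ P₂ * (M (blockIndex t) j * g j)
    with hB
  suffices h : ∀ l, (regCov (channelMatrix L u M P₁ P₂ l g) γ).det = (regCov B γ).det by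
    rw [h, h]
  intro l
  set U := Matrix.diagonal (phase L u l) with hU
  have hUU : U * U.conjTranspose = 1 := by
    rw [hU, Matrix.diagonal_conjTranspose, Matrix.diagonal_mul_diagonal, ← Matrix.diagonal_one]
    congr 1
    ext t
    simp [Complex.mul_conj, Complex.normSq_eq_norm_sq, norm_phase]
  have hC : channelMatrix L u M P₁ P₂ l g = U * B := by
    ext t j
    simp only [channelMatrix, Matrix.of_apply, hU, hB, Matrix.diagonal_mul]
    ring
  have : regCov (channelMatrix L u M P₁ P₂ l g) γ = U * regCov B γ * U.conjTranspose := by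
    rw [regCov, regCov, hC, Matrix.mul_add, Matrix.add_mul, Matrix.conjTranspose_mul]
    simp only [Matrix.mul_smul, Matrix.smul_mul, Matrix.mul_one, hUU, Matrix.mul_assoc]
  rw [this, Matrix.det_mul, Matrix.det_mul, mul_comm (U.det), mul_assoc, ← Matrix.det_mul, hUU,
    Matrix.det_one, mul_one]

lemma noiseVar_ge_one (hP₁ : 0 ≤ P₁) (hP₂ : 0 ≤ P₂) (g : Fin R → ℂ) : 1 ≤ noiseVar P₁ P₂ g := by
  unfold noiseVar
  have : 0 ≤ P₂ / (1 + P₁) * ∑ j, ‖g j‖ ^ 2 := by positivity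
  linarith

/-- If the likelihood prefers `l'` to the transmitted message `l`, then the received vector is
also explained by `l'` with fadings and residual of a comparable size. -/
lemma exists_explanation_of_likelihood_le (hR : 0 < R) (hP₁ : 0 ≤ P₁) (hP₂ : 0 ≤ P₂)
    (l l' : Message L) (g f : Fin R → ℂ) (y : Slot R → ℂ)
    (h : likelihood P₁ P₂ (codeword L u M l) g y ≤ likelihood P₁ P₂ (codeword L u M l') g y) :
    ∃ f' : Fin R → ℂ, ∑ j, ‖f' j‖ ^ 2 +
        (∑ t, ‖(y - (channelMatrix L u M P₁ P₂ l' g).mulVec f') t‖ ^ 2) / noiseVar P₁ P₂ g ≤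
      ∑ j, ‖f j‖ ^ 2 +
        (∑ t, ‖(y - (channelMatrix L u M P₁ P₂ l g).mulVec f) t‖ ^ 2) / noiseVar P₁ P₂ g := by
  have hγ : 0 < noiseVar P₁ P₂ g := by linarith [noiseVar_ge_one hP₁ hP₂ g]
  unfold likelihood at h
  rw [receivedCov_eq hR hP₁ hP₂, receivedCov_eq hR hP₁ hP₂, det_regCov_channelMatrix l l'] at h
  have hdet : 0 < (regCov (channelMatrix L u M P₁ P₂ l' g) (noiseVar P₁ P₂ g)).det.re :=
    (Complex.pos_iff.1 (regCov_posDef _ hγ).det_pos).1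
  rw [div_le_div_iff_of_pos_right (by positivity), Real.exp_le_exp, neg_le_neg_iff] at h
  obtain ⟨f', hf', -⟩ := exists_quadForm_eq (channelMatrix L u M P₁ P₂ l' g) hγ y
  obtain ⟨-, -, hf⟩ := exists_quadForm_eq (channelMatrix L u M P₁ P₂ l g) hγ y
  exact ⟨f', hf'.symm.le.trans (h.trans (hf f))⟩

end Receiver

section UpperBound

/-! ### Upper bound for the error rate -/

lemma exists_pos_forall_le {ι : Type*} [Finite ι] (a : ι → ℝ) (ha : ∀ i, 0 < a i) :
    ∃ κ : ℝ, 0 < κ ∧ ∀ i, κ ≤ a i := by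
  rcases isEmpty_or_nonempty ι with h | h
  · exact ⟨1, one_pos, fun i => h.elim i⟩
  · obtain ⟨i, hi⟩ := Finite.exists_min a
    exact ⟨a i, ha i, hi⟩

variable {R K : ℕ} {L : Fin K → ℕ} {u : Slot R → Fin K → ℕ} {M : Matrix (Fin R) (Fin R) ℂ}
  {P₁ P₂ : ℝ}

lemma norm_noise_le (hM : IsGBH M) {A X : ℝ} (hA1 : 1 ≤ A)
    (hA : P₂ / (1 + P₁) ≤ A) (hX : 1 ≤ X) {ω : Sample R} (hω : ‖ω‖ ≤ X) (t : Slot R) :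
    ‖noise P₁ P₂ M ω t‖ ≤ (R * A + 1) * X ^ 2 := by
  have hg : ∀ j, ‖ω.2.1 j‖ ≤ X := fun j =>
    (norm_le_pi_norm _ j).trans ((norm_fst_le ω.2).trans ((norm_snd_le ω).trans hω))
  have hn : ∀ j, ‖ω.2.2.1 j t‖ ≤ X := fun j =>
    (norm_le_pi_norm _ t).trans ((norm_le_pi_norm _ j).trans ((norm_fst_le ω.2.2).trans
      ((norm_snd_le ω.2).trans ((norm_snd_le ω).trans hω))))
  have hw : ‖ω.2.2.2 t‖ ≤ X :=
    (norm_le_pi_norm _ t).trans ((norm_snd_le ω.2.2).trans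
      ((norm_snd_le ω.2).trans ((norm_snd_le ω).trans hω)))
  have hb : Real.sqrt (P₂ / (1 + P₁)) ≤ A :=
    Real.sqrt_le_iff.2 ⟨by linarith, hA.trans (by nlinarith)⟩
  have hsum : ‖∑ j, ω.2.1 j * (Real.sqrt (P₂ / (1 + P₁)) * (gammaMatrix M t j * ω.2.2.1 j t))‖ ≤
      ∑ _j : Fin R, X * (A * (1 * X)) := by
    refine norm_sum_le_of_le _ fun j _ => ?_
    rw [norm_mul, norm_mul, norm_mul, hM.norm_gammaMatrix, Complex.norm_real, Real.norm_eq_abs,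
      abs_of_nonneg (Real.sqrt_nonneg _)]
    gcongr
    · exact hg j
    · exact hn j
  refine (norm_add_le _ _).trans ((add_le_add hsum hw).trans ?_)
  rw [Finset.sum_const, Finset.card_univ, Fintype.card_fin, nsmul_eq_mul]
  nlinarith

/-- If `l` is transmitted, all random variables are bounded by `X` and the likelihood prefers
another message, then all the products `g_j f_j` are small. -/
lemma exists_norm_fading_le (hR : 0 < R) (hM : IsGBH M)
    (hsep : ∀ l l' : Message L, l ≠ l' → ∀ i, phase L u l (Sum.inl i) * phase L u l' (Sum.inr i) ≠
      phase L u l (Sum.inr i) * phase L u l' (Sum.inl i))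
    {A c : ℝ} (hA1 : 1 ≤ A) (hc : 0 < c) :
    ∃ C : ℝ, 0 < C ∧ ∀ P₁ P₂ P X : ℝ, 0 ≤ P₁ → 0 ≤ P₂ → P₂ / (1 + P₁) ≤ A → 0 < P →
      c * P ≤ P₁ * P₂ / (P₁ + 1) → 1 ≤ X → ∀ l l' : Message L, l ≠ l' →
      ∀ ω : Sample R, ‖ω‖ ≤ X →
      likelihood P₁ P₂ (codeword L u M l) (destFading ω)
        (destReceived P₁ P₂ M (sourceVector L u l) ω) ≤
      likelihood P₁ P₂ (codeword L u M l') (destFading ω)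
        (destReceived P₁ P₂ M (sourceVector L u l) ω) →
      ∀ j, ‖ω.2.1 j * ω.1 j‖ ≤ C * (X ^ 3 / Real.sqrt P) := by
  -- κ bounds from below the finitely many 2×2 determinants of phases.
  obtain ⟨κ, hκ, hκle⟩ := exists_pos_forall_le
    (fun q : {q : Message L × Message L × Fin R // q.1 ≠ q.2.1} =>
      ‖phase L u q.1.1 (Sum.inl q.1.2.2) * phase L u q.1.2.1 (Sum.inr q.1.2.2) -
        phase L u q.1.1 (Sum.inr q.1.2.2) * phase L u q.1.2.1 (Sum.inl q.1.2.2)‖)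
    (fun q => norm_pos_iff.2 (sub_ne_zero.2 (hsep _ _ q.2 _)))
  have hR1 : (1 : ℝ) ≤ R := by exact_mod_cast hR
  -- B X² bounds both the noise and its variance γ. The squared residual for l' is at most 3R (B
  -- X²)² γ, whence D = 3R B³ and the power X⁶.
  set B : ℝ := R * A + 1 with hB
  have hB1 : 1 ≤ B := by nlinarith
  set D : ℝ := 3 * R * B ^ 3 with hD
  have hB3 : B ≤ B ^ 3 := le_self_pow₀ hB1 (by norm_num)
  have hDB : B ≤ D := by nlinarith
  have hD1 : 1 ≤ D := hB1.trans hDB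
  refine ⟨4 * D / (κ * Real.sqrt c), by positivity, ?_⟩
  intro P₁ P₂ P X hP₁ hP₂ hA hP hgain hX l l' hll ω hω hlik j
  set g := destFading ω with hg
  set f := ω.1 with hf
  set γ := noiseVar P₁ P₂ g with hγ
  have hf_le : ∀ j, ‖f j‖ ≤ X := fun j =>
    (norm_le_pi_norm _ j).trans ((norm_fst_le ω).trans hω)
  have hg_le : ∀ j, ‖g j‖ ≤ X := fun j =>
    (norm_le_pi_norm _ j).trans ((norm_fst_le ω.2).trans ((norm_snd_le ω).trans hω))
  have hη : ∀ t, ‖noise P₁ P₂ M ω t‖ ≤ B * X ^ 2 := norm_noise_le hM hA1 hA hX hω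
  have hγ1 : 1 ≤ γ := noiseVar_ge_one hP₁ hP₂ g
  have hX2 : 1 ≤ X ^ 2 := one_le_pow₀ hX
  have hγB : γ ≤ B * X ^ 2 := by
    have h1 : ∑ j, ‖g j‖ ^ 2 ≤ ∑ _j : Fin R, X ^ 2 :=
      Finset.sum_le_sum fun j _ => pow_le_pow_left₀ (norm_nonneg _) (hg_le j) 2
    rw [Finset.sum_const, Finset.card_univ, Fintype.card_fin, nsmul_eq_mul] at h1
    have h2 : P₂ / (1 + P₁) * ∑ j, ‖g j‖ ^ 2 ≤ A * (R * X ^ 2) := by gcongr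
    rw [hγ, noiseVar, hB]
    nlinarith
  set y := destReceived P₁ P₂ M (sourceVector L u l) ω with hy
  have hyeq : y = (channelMatrix L u M P₁ P₂ l g).mulVec f + noise P₁ P₂ M ω :=
    destReceived_eq hR hP₁ hP₂ l ω
  obtain ⟨f', hf'⟩ := exists_explanation_of_likelihood_le hR hP₁ hP₂ l l' g f y hlik
  set r := y - (channelMatrix L u M P₁ P₂ l' g).mulVec f' with hr
  have hres : y - (channelMatrix L u M P₁ P₂ l g).mulVec f = noise P₁ P₂ M ω := by
    rw [hyeq]; simp
  rw [hres] at hf'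
  have hNη : ∑ t, ‖noise P₁ P₂ M ω t‖ ^ 2 ≤ 2 * R * (B * X ^ 2) ^ 2 := by
    have h1 : ∑ t, ‖noise P₁ P₂ M ω t‖ ^ 2 ≤ ∑ _t : Slot R, (B * X ^ 2) ^ 2 :=
      Finset.sum_le_sum fun t _ => pow_le_pow_left₀ (norm_nonneg _) (hη t) 2
    rw [Finset.sum_const, Finset.card_univ, Fintype.card_sum, Fintype.card_fin,
      nsmul_eq_mul] at h1
    refine h1.trans (le_of_eq ?_)
    push_cast
    ring
  have hNf : ∑ j, ‖f j‖ ^ 2 ≤ R * X ^ 2 := by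
    have h1 : ∑ j, ‖f j‖ ^ 2 ≤ ∑ _j : Fin R, X ^ 2 :=
      Finset.sum_le_sum fun j _ => pow_le_pow_left₀ (norm_nonneg _) (hf_le j) 2
    rwa [Finset.sum_const, Finset.card_univ, Fintype.card_fin, nsmul_eq_mul] at h1
  have hNηγ : (∑ t, ‖noise P₁ P₂ M ω t‖ ^ 2) / γ ≤ 2 * R * (B * X ^ 2) ^ 2 :=
    (div_le_self (by positivity) hγ1).trans hNη
  have hBX : 1 ≤ B * X ^ 2 := one_le_mul_of_one_le_of_one_le hB1 hX2
  have hRHS : ∑ j, ‖f' j‖ ^ 2 + (∑ t, ‖r t‖ ^ 2) / γ ≤ 3 * R * (B * X ^ 2) ^ 2 := by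
    have h1 : X ^ 2 ≤ (B * X ^ 2) ^ 2 := by
      have : X ^ 2 ≤ B * X ^ 2 := by nlinarith
      nlinarith
    have h2 : (R : ℝ) * X ^ 2 ≤ R * (B * X ^ 2) ^ 2 := by gcongr
    linarith
  have hNr : ∑ t, ‖r t‖ ^ 2 ≤ D * X ^ 6 := by
    have h0 : 0 ≤ ∑ j, ‖f' j‖ ^ 2 := by positivity
    have h1 : (∑ t, ‖r t‖ ^ 2) / γ ≤ 3 * R * (B * X ^ 2) ^ 2 := by linarith
    rw [div_le_iff₀ (by linarith)] at h1
    calc ∑ t, ‖r t‖ ^ 2 ≤ 3 * R * (B * X ^ 2) ^ 2 * γ := h1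
      _ ≤ 3 * R * (B * X ^ 2) ^ 2 * (B * X ^ 2) := by gcongr
      _ = D * X ^ 6 := by rw [hD]; ring
  have hr_le : ∀ t, ‖r t‖ ≤ D * X ^ 3 := by
    intro t
    have h1 : ‖r t‖ ^ 2 ≤ ∑ t, ‖r t‖ ^ 2 :=
      Finset.single_le_sum (f := fun t => ‖r t‖ ^ 2) (fun t _ => by positivity)
        (Finset.mem_univ t)
    refine le_of_sq_le_sq ?_ (by positivity)
    calc ‖r t‖ ^ 2 ≤ D * X ^ 6 := h1.trans hNr
      _ ≤ D * D * X ^ 6 := by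
          have : D ≤ D * D := by nlinarith
          gcongr
      _ = (D * X ^ 3) ^ 2 := by ring
  have hη3 : ∀ t, ‖noise P₁ P₂ M ω t‖ ≤ D * X ^ 3 := fun t =>
    (hη t).trans (mul_le_mul hDB (pow_le_pow_right₀ hX (by norm_num)) (by positivity)
      (by positivity))
  set a : ℝ := gain P₁ P₂ with ha
  have ha_ge : Real.sqrt c * Real.sqrt P ≤ a := by
    rw [← Real.sqrt_mul hc.le]
    exact Real.sqrt_le_sqrt hgain
  set v := M.mulVec (g * f) with hv
  set v' := M.mulVec (g * f') with hv'
  have hd : ∀ t, (a : ℂ) * phase L u l t * v (blockIndex t) -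
      a * phase L u l' t * v' (blockIndex t) = r t - noise P₁ P₂ M ω t := by
    intro t
    have h1 := congrFun hr t
    rw [hyeq] at h1
    simp only [Pi.sub_apply, Pi.add_apply, channelMatrix_mulVec] at h1
    rw [h1]
    ring
  have hv_le : ∀ i, ‖v i‖ ≤ 4 * D / (κ * Real.sqrt c) * (X ^ 3 / Real.sqrt P) := by
    intro i
    have h1 := hd (Sum.inl i)
    have h2 := hd (Sum.inr i)
    simp only [blockIndex, Sum.elim_inl, Sum.elim_inr, id] at h1 h2
    set dl := r (Sum.inl i) - noise P₁ P₂ M ω (Sum.inl i) with hdl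
    set dr := r (Sum.inr i) - noise P₁ P₂ M ω (Sum.inr i) with hdr
    have hdl_le : ‖dl‖ ≤ 2 * (D * X ^ 3) :=
      (norm_sub_le _ _).trans (by linarith [hr_le (Sum.inl i), hη3 (Sum.inl i)])
    have hdr_le : ‖dr‖ ≤ 2 * (D * X ^ 3) :=
      (norm_sub_le _ _).trans (by linarith [hr_le (Sum.inr i), hη3 (Sum.inr i)])
    -- Cramer's rule: the combination of the two equations of block i which eliminates v'_i.
    have h3 : (a : ℂ) * ((phase L u l (Sum.inl i) * phase L u l' (Sum.inr i) -
        phase L u l (Sum.inr i) * phase L u l' (Sum.inl i)) * v i) =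
        phase L u l' (Sum.inr i) * dl - phase L u l' (Sum.inl i) * dr := by
      linear_combination phase L u l' (Sum.inr i) * h1 - phase L u l' (Sum.inl i) * h2
    have h4 := congrArg norm h3
    rw [norm_mul, norm_mul, Complex.norm_real, Real.norm_eq_abs,
      abs_of_nonneg (show 0 ≤ a from Real.sqrt_nonneg _)] at h4
    have h5 : ‖phase L u l' (Sum.inr i) * dl - phase L u l' (Sum.inl i) * dr‖ ≤
        4 * (D * X ^ 3) := by
      refine (norm_sub_le _ _).trans ?_
      rw [norm_mul, norm_mul, norm_phase, norm_phase]
      linarith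
    have h6 : (Real.sqrt c * Real.sqrt P) * (κ * ‖v i‖) ≤ 4 * (D * X ^ 3) := by
      refine le_trans ?_ (h4.le.trans h5)
      have h7 := hκle ⟨(l, l', i), hll⟩
      exact mul_le_mul ha_ge (mul_le_mul_of_nonneg_right h7 (norm_nonneg _)) (by positivity)
        (Real.sqrt_nonneg _)
    have hsP : 0 < Real.sqrt P := Real.sqrt_pos.2 hP
    have hsc : 0 < Real.sqrt c := Real.sqrt_pos.2 hc
    rw [div_mul_div_comm, le_div_iff₀ (by positivity)]
    linarith
  -- Since Mᴴ M = R I, the products g_j f_j are averages of the v_i with unimodular weights.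
  have hgf : (R : ℂ) * (g j * f j) = ∑ i, star (M i j) * v i := by
    have h1 : M.conjTranspose.mulVec v = (R : ℂ) • (g * f) := by
      rw [hv, Matrix.mulVec_mulVec, hM.conjTranspose_mul, Matrix.smul_mulVec, Matrix.one_mulVec]
    have h2 := congrFun h1 j
    simp only [Matrix.mulVec, dotProduct, Matrix.conjTranspose_apply, Pi.smul_apply,
      Pi.mul_apply, smul_eq_mul] at h2
    exact h2.symm
  have h7 : (R : ℝ) * ‖g j * f j‖ ≤ R * (4 * D / (κ * Real.sqrt c) * (X ^ 3 / Real.sqrt P)) := by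
    have h8 := congrArg norm hgf
    rw [norm_mul, Complex.norm_natCast] at h8
    rw [h8]
    have h9 : ∀ i ∈ Finset.univ, ‖star (M i j) * v i‖ ≤
        4 * D / (κ * Real.sqrt c) * (X ^ 3 / Real.sqrt P) := fun i _ => by
      rw [norm_mul, norm_star, hM.norm_entry, one_mul]
      exact hv_le i
    refine (norm_sum_le_of_le _ h9).trans (le_of_eq ?_)
    rw [Finset.sum_const, Finset.card_univ, Fintype.card_fin, nsmul_eq_mul]
  exact le_of_mul_le_mul_left h7 (by linarith)

lemma sampleLaw_fading_small (δ : ℝ) :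
    (sampleLaw R) {ω | ∀ j, ‖ω.2.1 j * ω.1 j‖ ≤ δ} =
      ((cscg.prod cscg) {p : ℂ × ℂ | ‖p.2 * p.1‖ ≤ δ}) ^ R := by
  have h1 : MeasurePreserving (Prod.map id Prod.fst) (sampleLaw R)
      ((Measure.pi fun _ : Fin R => cscg).prod (Measure.pi fun _ : Fin R => cscg)) :=
    (MeasurePreserving.id _).prod measurePreserving_fst
  have h2 : MeasurableSet {p : (Fin R → ℂ) × (Fin R → ℂ) | ∀ j, ‖p.2 j * p.1 j‖ ≤ δ} := by
    rw [Set.ofPred_forall]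
    refine MeasurableSet.iInter fun j => measurableSet_le ?_ measurable_const
    fun_prop
  have h3 := measure_prod_small_eq (ι := Fin R) δ
  rw [Fintype.card_fin] at h3
  rw [← h3, ← h1.measure_preimage h2.nullMeasurableSet]
  rfl

lemma sourcePower_relayPower_bounds (hR : 0 < R) {α : ℝ} (hα₀ : 0 < α) (hα₁ : α < 1) {P : ℝ}
    (hP : 1 ≤ P) :
    0 ≤ sourcePower α P ∧ 0 ≤ relayPower R α P ∧
    relayPower R α P / (1 + sourcePower α P) ≤ 1 / α ∧
    α * (1 - α) / (2 * R) * P ≤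
      sourcePower α P * relayPower R α P / (sourcePower α P + 1) ∧
    sourcePower α P * relayPower R α P / (sourcePower α P + 1) ≤ P := by
  have hR1 : (1 : ℝ) ≤ R := by exact_mod_cast hR
  have h1α : 0 < 1 - α := by linarith
  unfold sourcePower relayPower
  have hαP : 0 < α * P := by positivity
  have hq : 0 ≤ (1 - α) * P / R := by positivity
  have hqP : (1 - α) * P / R ≤ P := by
    rw [div_le_iff₀ (by positivity)]
    nlinarith
  refine ⟨hαP.le, hq, ?_, ?_, ?_⟩
  · rw [div_le_div_iff₀ (by positivity) hα₀]
    nlinarith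
  · rw [le_div_iff₀ (by positivity)]
    have h3 : α * P + 1 ≤ 2 * P := by nlinarith
    calc α * (1 - α) / (2 * R) * P * (α * P + 1) ≤ α * (1 - α) / (2 * R) * P * (2 * P) := by
          gcongr
      _ = α * P * ((1 - α) * P / R) := by field_simp
  · rw [div_le_iff₀ (by positivity)]
    nlinarith

variable {dec : ℝ → (Fin R → ℂ) → (Slot R → ℂ) → Message L}

/-- Under the separation condition the error rate decreases at least like `P ^ (-R + δ)`. -/
lemma exists_blockErrorRate_le (hR : 0 < R) (hM : IsGBH M)
    (hsep : ∀ l l' : Message L, l ≠ l' → ∀ i, phase L u l (Sum.inl i) * phase L u l' (Sum.inr i) ≠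
      phase L u l (Sum.inr i) * phase L u l' (Sum.inl i))
    {α : ℝ} (hα₀ : 0 < α) (hα₁ : α < 1)
    (hdec : ∀ P : ℝ, 0 < P → IsMLDecoder (sourcePower α P) (relayPower R α P) L u M (dec P))
    {δ : ℝ} (hδ : 0 < δ) :
    ∃ C : ℝ, 0 < C ∧ ∀ P : ℝ, 1 ≤ P →
      blockErrorRate (sourcePower α P) (relayPower R α P) L u M (dec P) ≤ C * P ^ (δ - R) := by
  have hR1 : (1 : ℝ) ≤ R := by exact_mod_cast hR
  have h1α : 0 < 1 - α := by linarith
  obtain ⟨C₀, hC₀, hfad⟩ := exists_norm_fading_le (A := 1 / α) (c := α * (1 - α) / (2 * R)) hR hM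
    hsep (by rw [le_div_iff₀ hα₀]; linarith) (by positivity)
  -- With X = P^ε the fading threshold is of order P^(3ε - 1/2). Raising it to the power (2 - ε)R
  -- gives an exponent at most (7ε - 1)R ≤ δ - R. The tail order k below satisfies kε ≥ R, so X^(-k)
  -- ≤ P^(-R).
  set ε : ℝ := min 1 (δ / (7 * R)) with hε
  have hε0 : 0 < ε := by positivity
  have hε1 : ε ≤ 1 := min_le_left _ _
  have hεδ : 7 * R * ε ≤ δ := by
    have : ε ≤ δ / (7 * R) := min_le_right _ _
    rwa [le_div_iff₀ (by positivity), mul_comm] at this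
  obtain ⟨k, hk⟩ := exists_nat_ge (R / ε)
  rw [div_le_iff₀ hε0] at hk
  obtain ⟨C₁, hC₁, htail⟩ := hasFastTails_sampleLaw R k
  obtain ⟨C₂, hC₂, hsmall⟩ := exists_cscg_prod_le (s := 2 - ε) (by linarith) (by linarith)
  refine ⟨C₁ + (C₂ * C₀ ^ (2 - ε)) ^ R, by positivity, fun P hP => ?_⟩
  have hP0 : 0 < P := by linarith
  obtain ⟨hP₁, hP₂, hA, hgain, -⟩ := sourcePower_relayPower_bounds hR hα₀ hα₁ hP
  set X : ℝ := P ^ ε with hX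
  have hX1 : 1 ≤ X := Real.one_le_rpow hP hε0.le
  have hX0 : 0 < X := by linarith
  set d : ℝ := C₀ * (X ^ 3 / Real.sqrt P) with hd
  have hsP : 0 < Real.sqrt P := Real.sqrt_pos.2 hP0
  have hdeq : d = C₀ * P ^ (3 * ε - 1 / 2) := by
    rw [hd, hX, Real.sqrt_eq_rpow, ← Real.rpow_natCast, ← Real.rpow_mul hP0.le,
      ← Real.rpow_sub hP0]
    push_cast
    ring_nf
  have hbound : ∀ l : Message L, (sampleLaw R).real {ω | dec P (destFading ω)
      (destReceived (sourcePower α P) (relayPower R α P) M (sourceVector L u l) ω) ≠ l} ≤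
      (C₁ + (C₂ * C₀ ^ (2 - ε)) ^ R) * P ^ (δ - R) := by
    intro l
    have hsub : {ω | dec P (destFading ω)
        (destReceived (sourcePower α P) (relayPower R α P) M (sourceVector L u l) ω) ≠ l} ⊆
        {ω : Sample R | X < ‖ω‖} ∪ {ω | ∀ j, ‖ω.2.1 j * ω.1 j‖ ≤ d} := by
      intro ω hω
      by_cases hωX : ‖ω‖ ≤ X
      · right
        exact hfad _ _ P X hP₁ hP₂ hA hP0 hgain hX1 l _ (Ne.symm hω) ω hωX
          ((hdec P hP0).maximizes _ _ l)
      · left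
        simpa using hωX
    have h1 := (measure_mono hsub).trans (measure_union_le (μ := sampleLaw R) _ _)
    rw [sampleLaw_fading_small] at h1
    have h2 := h1.trans (add_le_add (htail X hX0)
      (pow_le_pow_left₀ zero_le (hsmall d (by positivity)) R))
    rw [← ENNReal.ofReal_pow (by positivity), ← ENNReal.ofReal_add (by positivity)
      (by positivity)] at h2
    have h3 := ENNReal.toReal_le_of_le_ofReal (by positivity) h2
    refine h3.trans ?_
    rw [add_mul]
    refine add_le_add ?_ ?_
    · gcongr
      rw [hX, ← Real.rpow_natCast, ← Real.rpow_mul hP0.le, ← Real.rpow_neg hP0.le]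
      refine Real.rpow_le_rpow_of_exponent_le hP ?_
      linarith
    · rw [hdeq, Real.mul_rpow hC₀.le (by positivity), ← mul_assoc, mul_pow _ ((_ : ℝ) ^ (2 - ε))]
      gcongr
      rw [← Real.rpow_mul hP0.le, ← Real.rpow_natCast, ← Real.rpow_mul hP0.le]
      refine Real.rpow_le_rpow_of_exponent_le hP ?_
      have h4 : (3 * ε - 1 / 2) * (2 - ε) ≤ 7 * ε - 1 := by nlinarith
      calc (3 * ε - 1 / 2) * (2 - ε) * R ≤ (7 * ε - 1) * R := by gcongr
        _ ≤ δ - R := by linarith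
  rw [blockErrorRate]
  refine div_le_of_le_mul₀ (by positivity) (by positivity) ?_
  refine (Finset.sum_le_sum fun l _ => hbound l).trans (le_of_eq ?_)
  rw [Finset.sum_const, nsmul_eq_mul, Finset.card_univ, mul_comm]

end UpperBound

section ChangeOfVariables

/-! ### Lower bound for the error rate -/

lemma det_restrictScalars_toLin' {n : Type*} [Fintype n] [DecidableEq n] (W : Matrix n n ℂ) :
    LinearMap.det ((Matrix.toLin' W).restrictScalars ℝ) = ‖W.det‖ ^ 2 := by
  rw [LinearMap.det_restrictScalars, LinearMap.det_toLin', Algebra.norm_complex_apply,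
    Complex.normSq_eq_norm_sq]

lemma volume_preimage_mulVec {n : Type*} [Fintype n] [DecidableEq n] {W : Matrix n n ℂ}
    (hW : W.det ≠ 0) (s : Set (n → ℂ)) :
    volume ((fun x => W.mulVec x) ⁻¹' s) = ENNReal.ofReal ((‖W.det‖ ^ 2)⁻¹) * volume s := by
  have h := Measure.addHaar_preimage_linearMap (volume : Measure (n → ℂ))
    (f := (Matrix.toLin' W).restrictScalars ℝ)
    (by rw [det_restrictScalars_toLin']; exact pow_ne_zero 2 (norm_ne_zero_iff.2 hW)) s
  rw [det_restrictScalars_toLin', abs_of_nonneg (by positivity)] at h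
  exact h

/-- A complex matrix has real Jacobian |det W|². Only this modulus matters; `twist` need not be
unitary. -/
lemma map_mulVec_volume {n : Type*} [Fintype n] [DecidableEq n] {W : Matrix n n ℂ}
    (hW : ‖W.det‖ = 1) :
    Measure.map (fun x => W.mulVec x) (volume : Measure (n → ℂ)) = volume := by
  have hm : Measurable fun x : n → ℂ => W.mulVec x :=
    (Continuous.matrix_mulVec continuous_const continuous_id).measurable
  ext s hs
  rw [Measure.map_apply hm hs, volume_preimage_mulVec (by rw [← norm_ne_zero_iff, hW]; simp), hW]
  simp

/-- Each block in N contributes a disc of area π/P, the others discs of area π. This is the source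
of the exponent |N|. -/
lemma volume_polydisc {ι : Type*} [Fintype ι] (N : Finset ι) [DecidableEq ι] {P : ℝ} (hP : 0 < P) :
    volume {v : ι → ℂ | ∀ k, ‖v k‖ ^ 2 ≤ if k ∈ N then P⁻¹ else 1} =
      ENNReal.ofReal (P⁻¹ ^ N.card) * ENNReal.ofReal Real.pi ^ Fintype.card ι := by
  have h1 : {v : ι → ℂ | ∀ k, ‖v k‖ ^ 2 ≤ if k ∈ N then P⁻¹ else 1} =
      Set.univ.pi fun k => Metric.closedBall (0 : ℂ) (Real.sqrt (if k ∈ N then P⁻¹ else 1)) := by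
    ext v
    simp only [Set.mem_ofPred_eq, Set.mem_univ_pi, mem_closedBall_zero_iff]
    refine forall_congr' fun k => ?_
    rw [Real.le_sqrt (norm_nonneg _) (by split_ifs <;> positivity)]
  rw [h1, volume_pi_pi]
  have h2 : ∀ k, volume (Metric.closedBall (0 : ℂ) (Real.sqrt (if k ∈ N then P⁻¹ else 1))) =
      ENNReal.ofReal (if k ∈ N then P⁻¹ else 1) * ENNReal.ofReal Real.pi := by
    intro k
    rw [Complex.volume_closedBall, ← ENNReal.ofReal_pow (Real.sqrt_nonneg _),
      Real.sq_sqrt (by split_ifs <;> positivity)]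
    congr 1
    simp [ENNReal.ofReal, Real.toNNReal_of_nonneg Real.pi_pos.le]
    rfl
  simp only [h2, Finset.prod_mul_distrib, Finset.prod_const, Finset.card_univ]
  congr 1
  rw [← ENNReal.ofReal_prod_of_nonneg (fun k _ => by split_ifs <;> positivity)]
  congr 1
  rw [Finset.prod_ite]
  simp

/-! ### A measure-preserving exchange of two messages -/

variable {R K : ℕ} {L : Fin K → ℕ} {u : Slot R → Fin K → ℕ} {M : Matrix (Fin R) (Fin R) ℂ}
  {P₁ P₂ : ℝ}

variable (R) in
/-- The fadings `g` with moduli between `1` and `2`. -/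
def annulus : Set (Fin R → ℂ) := Set.univ.pi fun _ => {z | 1 ≤ ‖z‖ ∧ ‖z‖ ≤ 2}

lemma measurableSet_annulus : MeasurableSet (annulus R) :=
  MeasurableSet.univ_pi fun _ =>
    (measurableSet_le measurable_const measurable_norm).inter
      (measurableSet_le measurable_norm measurable_const)

lemma annulus_pos : (Measure.pi fun _ : Fin R => cscg) (annulus R) ≠ 0 := by
  rw [annulus, Measure.pi_pi, Finset.prod_ne_zero_iff]
  intro _ _
  obtain ⟨c, hc0, -, hc⟩ := exists_smul_restrict_le_cscg 2
  have hsub : Metric.ball (3 / 2 : ℂ) (1 / 2) ⊆ {z : ℂ | 1 ≤ ‖z‖ ∧ ‖z‖ ≤ 2} := by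
    intro z hz
    rw [mem_ball_iff_norm] at hz
    have h1 : ‖(3 / 2 : ℂ)‖ = 3 / 2 := by norm_num
    have h2 := abs_le.1 ((abs_norm_sub_norm_le z (3 / 2)).trans hz.le)
    rw [h1] at h2
    exact ⟨by linarith [h2.1], by linarith [h2.2]⟩
  refine ne_of_gt (lt_of_lt_of_le ?_ ((hc _).trans (measure_mono hsub)))
  have hsub2 : Metric.ball (3 / 2 : ℂ) (1 / 2) ⊆ Metric.closedBall 0 2 := fun z hz => by
    simpa using (hsub hz).2
  rw [Measure.smul_apply, Measure.restrict_eq_self _ hsub2, smul_eq_mul]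
  exact ENNReal.mul_pos hc0 (Metric.measure_ball_pos _ _ (by norm_num)).ne'

/-- The rotation of the block `i` which turns the first coordinate of `l'` into that of `l`. -/
def turn (L : Fin K → ℕ) (u : Slot R → Fin K → ℕ) (l l' : Message L) (i : Fin R) : ℂ :=
  phase L u l (Sum.inl i) / phase L u l' (Sum.inl i)

lemma norm_turn (l l' : Message L) (i : Fin R) : ‖turn L u l l' i‖ = 1 := by
  rw [turn, norm_div, norm_phase, norm_phase, div_one]

variable (L u M) in
/-- The linear map of the fadings `f` which rotates the blocks of `M (g f)` by `turn`. -/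
def twist (l l' : Message L) (g : Fin R → ℂ) : Matrix (Fin R) (Fin R) ℂ :=
  Matrix.diagonal (fun j => (g j)⁻¹) * (M⁻¹ * Matrix.diagonal (turn L u l l') * M) *
    Matrix.diagonal g

lemma ne_zero_of_mem_annulus {g : Fin R → ℂ} (hg : g ∈ annulus R) (j : Fin R) : g j ≠ 0 := by
  have h : 1 ≤ ‖g j‖ := (hg j (Set.mem_univ j)).1
  rw [← norm_pos_iff]
  linarith

lemma norm_det_twist (hdet : M.det ≠ 0) (l l' : Message L) {g : Fin R → ℂ}
    (hg : g ∈ annulus R) : ‖(twist L u M l l' g).det‖ = 1 := by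
  have h1 : (M⁻¹).det * M.det = 1 := by
    rw [← Matrix.det_mul, Matrix.nonsing_inv_mul _ hdet.isUnit, Matrix.det_one]
  have h2 : (∏ j, (g j)⁻¹) * ∏ j, g j = 1 := by
    rw [← Finset.prod_mul_distrib]
    exact Finset.prod_eq_one fun j _ => inv_mul_cancel₀ (ne_zero_of_mem_annulus hg j)
  simp only [twist, Matrix.det_mul, Matrix.det_diagonal]
  have h3 : (∏ j, (g j)⁻¹) * ((M⁻¹).det * (∏ i, turn L u l l' i) * M.det) * ∏ j, g j =
      ∏ i, turn L u l l' i := by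
    linear_combination (∏ i, turn L u l l' i) * h1 * ((∏ j, (g j)⁻¹) * ∏ j, g j) +
      (∏ i, turn L u l l' i) * h2
  rw [h3, norm_prod]
  exact Finset.prod_eq_one fun i _ => norm_turn l l' i

lemma mulVec_twist (hdet : M.det ≠ 0) (l l' : Message L) {g : Fin R → ℂ} (hg : g ∈ annulus R)
    (f : Fin R → ℂ) :
    M.mulVec (g * (twist L u M l l' g).mulVec f) = turn L u l l' * M.mulVec (g * f) := by
  have hd : ∀ a b : Fin R → ℂ, (Matrix.diagonal a).mulVec b = a * b := fun a b => by
    ext i; simp [Matrix.mulVec_diagonal]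
  have h1 : g * (twist L u M l l' g).mulVec f =
      (M⁻¹).mulVec (turn L u l l' * M.mulVec (g * f)) := by
    simp only [twist, ← Matrix.mulVec_mulVec, hd]
    ext j
    simp only [Pi.mul_apply]
    rw [← mul_assoc, mul_inv_cancel₀ (ne_zero_of_mem_annulus hg j), one_mul]
  rw [h1, Matrix.mulVec_mulVec, Matrix.mul_nonsing_inv _ hdet.isUnit, Matrix.one_mulVec]

lemma measurable_twist (l l' : Message L) :
    Measurable fun p : (Fin R → ℂ) × (Fin R → ℂ) => (twist L u M l l' p.1).mulVec p.2 := by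
  simp only [twist, ← Matrix.mulVec_mulVec]
  refine measurable_pi_lambda _ fun j => ?_
  simp only [Matrix.mulVec_diagonal]
  refine ((measurable_pi_apply j).comp measurable_fst).inv.mul ?_
  have hc : Continuous fun x : Fin R → ℂ =>
      (M⁻¹).mulVec ((Matrix.diagonal (turn L u l l')).mulVec (M.mulVec x)) :=
    Continuous.matrix_mulVec continuous_const (Continuous.matrix_mulVec continuous_const
      (Continuous.matrix_mulVec continuous_const continuous_id))
  refine (continuous_pi_iff.1 hc j).measurable.comp ?_
  refine measurable_pi_lambda _ fun i => ?_
  simp only [Matrix.mulVec_diagonal]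
  fun_prop

variable (L u M P₁ P₂) in
/-- The difference of the noiseless received vectors for `l` and `f`, and for `l'` and the
twisted `f`. -/
def shift (l l' : Message L) (p : (Fin R → ℂ) × (Fin R → ℂ)) : Slot R → ℂ :=
  (channelMatrix L u M P₁ P₂ l p.1).mulVec p.2 -
    (channelMatrix L u M P₁ P₂ l' p.1).mulVec ((twist L u M l l' p.1).mulVec p.2)

lemma measurable_channelMatrix_mulVec (l : Message L) :
    Measurable fun p : (Fin R → ℂ) × (Fin R → ℂ) =>
      (channelMatrix L u M P₁ P₂ l p.1).mulVec p.2 := by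
  refine measurable_pi_lambda _ fun t => ?_
  simp only [channelMatrix, Matrix.mulVec, dotProduct, Matrix.of_apply]
  fun_prop

lemma measurable_shift (l l' : Message L) : Measurable (shift L u M P₁ P₂ l l') :=
  (measurable_channelMatrix_mulVec l).sub
    ((measurable_channelMatrix_mulVec l').comp (measurable_fst.prodMk (measurable_twist l l')))

/-- Outside N the rotation aligns both slots of a block, so the shift vanishes. Inside N it is at
most √P · 2 · P^(-1/2), the 2 coming from a difference of two unit phases. -/
lemma norm_shift_le (hdet : M.det ≠ 0) (l l' : Message L) {g f : Fin R → ℂ}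
    (hg : g ∈ annulus R) (N : Finset (Fin R))
    (hN : ∀ i ∉ N, phase L u l (Sum.inl i) * phase L u l' (Sum.inr i) =
      phase L u l (Sum.inr i) * phase L u l' (Sum.inl i)) {P : ℝ} (hP : 0 < P)
    (hgain : P₁ * P₂ / (P₁ + 1) ≤ P)
    (hv : ∀ k, ‖M.mulVec (g * f) k‖ ^ 2 ≤ if k ∈ N then P⁻¹ else 1) (t : Slot R) :
    ‖shift L u M P₁ P₂ l l' (g, f) t‖ ≤ 2 := by
  have h1 : shift L u M P₁ P₂ l l' (g, f) t = gain P₁ P₂ * ((phase L u l t -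
      phase L u l' t * turn L u l l' (blockIndex t)) * M.mulVec (g * f) (blockIndex t)) := by
    simp only [shift, Pi.sub_apply, channelMatrix_mulVec, mulVec_twist hdet l l' hg, Pi.mul_apply]
    ring
  set i := blockIndex t with hi
  by_cases hiN : i ∈ N
  · have h2 := hv i
    rw [if_pos hiN] at h2
    have h3 : ‖phase L u l t - phase L u l' t * turn L u l l' i‖ ≤ 2 := by
      refine (norm_sub_le _ _).trans ?_
      rw [norm_mul, norm_phase, norm_phase, norm_turn]
      norm_num
    have h4 : |gain P₁ P₂| ≤ Real.sqrt P := by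
      rw [abs_of_nonneg (show 0 ≤ gain P₁ P₂ from Real.sqrt_nonneg _)]
      exact Real.sqrt_le_sqrt hgain
    have h5 : ‖M.mulVec (g * f) i‖ ≤ Real.sqrt P⁻¹ := Real.le_sqrt_of_sq_le h2
    rw [h1, norm_mul, norm_mul, Complex.norm_real, Real.norm_eq_abs]
    calc |gain P₁ P₂| * (‖phase L u l t - phase L u l' t * turn L u l l' i‖ *
          ‖M.mulVec (g * f) i‖) ≤ Real.sqrt P * (2 * Real.sqrt P⁻¹) := by gcongr
      _ = 2 * (Real.sqrt P * Real.sqrt P⁻¹) := by ring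
      _ = 2 := by
        rw [← Real.sqrt_mul hP.le, mul_inv_cancel₀ hP.ne', Real.sqrt_one, mul_one]
  · have h2 : phase L u l t - phase L u l' t * turn L u l l' i = 0 := by
      have h3 := hN i hiN
      have h4 : phase L u l' (Sum.inl i) ≠ 0 := phase_ne_zero _ _
      rw [turn]
      rcases t with k | k
      · have : i = k := rfl
        rw [this] at h4 ⊢
        field_simp
        ring
      · have : i = k := rfl
        rw [this] at h3 h4 ⊢
        field_simp
        linear_combination -h3
    rw [h1, h2]
    simp

variable (L u M P₁ P₂) in
/-- The change of variables which turns the received vector for `l` into that for `l'`. -/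
def swapMap (l l' : Message L) (ω : Sample R) : Sample R :=
  ((twist L u M l l' ω.2.1).mulVec ω.1, ω.2.1, ω.2.2.1,
    ω.2.2.2 + shift L u M P₁ P₂ l l' (ω.2.1, ω.1))

/-- The shift added to the destination noise compensates exactly for the change of message and of
fadings; g and the relay noise are untouched. -/
lemma destReceived_swapMap (hR : 0 < R) (hP₁ : 0 ≤ P₁) (hP₂ : 0 ≤ P₂) (l l' : Message L)
    (ω : Sample R) :
    destReceived P₁ P₂ M (sourceVector L u l') (swapMap L u M P₁ P₂ l l' ω) =
      destReceived P₁ P₂ M (sourceVector L u l) ω := by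
  rw [destReceived_eq hR hP₁ hP₂, destReceived_eq hR hP₁ hP₂]
  ext t
  simp only [swapMap, noise, shift, destFading, Pi.add_apply, Pi.sub_apply]
  ring

variable (R) in
/-- Lebesgue measure in the fadings `f` and in the noise at the destination, the Gaussian law in
the other variables. -/
def refMeasure : Measure (Sample R) :=
  volume.prod (((Measure.pi fun _ : Fin R => cscg).restrict (annulus R)).prod
    ((Measure.pi fun _ : Fin R => Measure.pi fun _ : Slot R => cscg).prod volume))

lemma measurePreserving_prod_of_ae {α β : Type*} [MeasurableSpace α] [MeasurableSpace β]
    {μ : Measure α} {ν : Measure β} [SFinite μ] [SFinite ν] {T : β → α → α}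
    (hT : Measurable (Function.uncurry T)) (hmap : ∀ᵐ b ∂ν, Measure.map (T b) μ = μ) :
    MeasurePreserving (fun p : α × β => (T p.2 p.1, p.2)) (μ.prod ν) (μ.prod ν) :=
  (Measure.measurePreserving_swap.comp ((MeasurePreserving.id ν).skew_product hT hmap)).comp
    Measure.measurePreserving_swap

lemma measurePreserving_prod_add {α β γ E : Type*} [MeasurableSpace α] [MeasurableSpace β]
    [MeasurableSpace γ] [AddGroup E] [MeasurableSpace E] [MeasurableAdd₂ E] (μ : Measure α)
    (ν : Measure β) (κ : Measure γ) (μE : Measure E) [SFinite μ] [SFinite ν] [SFinite κ]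
    [SFinite μE] [μE.IsAddRightInvariant] {s : β × α → E} (hs : Measurable s) :
    MeasurePreserving (fun p : α × β × γ × E => (p.1, p.2.1, p.2.2.1, p.2.2.2 + s (p.2.1, p.1)))
      (μ.prod (ν.prod (κ.prod μE))) (μ.prod (ν.prod (κ.prod μE))) := by
  have h2 : ∀ a, MeasurePreserving (fun x : β × γ × E => (x.1, x.2.1, x.2.2 + s (x.1, a)))
      (ν.prod (κ.prod μE)) (ν.prod (κ.prod μE)) := by
    intro a
    refine (MeasurePreserving.id ν).skew_product
      (g := fun (b : β) (x : γ × E) => (x.1, x.2 + s (b, a))) ?_ (Eventually.of_forall fun b => ?_)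
    · simp only [Function.uncurry_def]
      fun_prop
    · exact ((MeasurePreserving.id κ).prod (measurePreserving_add_right μE (s (b, a)))).map_eq
  refine (MeasurePreserving.id μ).skew_product
    (g := fun (a : α) (x : β × γ × E) => (x.1, x.2.1, x.2.2 + s (x.1, a))) ?_
    (Eventually.of_forall fun a => (h2 a).map_eq)
  simp only [Function.uncurry_def]
  fun_prop

lemma measurePreserving_swapMap_of_ae (hdet : M.det ≠ 0) (l l' : Message L)
    (μ : Measure (Fin R → ℂ)) (κ : Measure (Fin R → Slot R → ℂ)) [SFinite μ] [SFinite κ]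
    (hμ : ∀ᵐ g ∂μ, g ∈ annulus R) :
    MeasurePreserving (swapMap L u M P₁ P₂ l l')
      (volume.prod (μ.prod (κ.prod (volume : Measure (Slot R → ℂ)))))
      (volume.prod (μ.prod (κ.prod (volume : Measure (Slot R → ℂ))))) := by
  have hm : Measurable (Function.uncurry
      fun (x : (Fin R → ℂ) × (Fin R → Slot R → ℂ) × (Slot R → ℂ)) (f : Fin R → ℂ) =>
        (twist L u M l l' x.1).mulVec f) := by
    have h : Measurable fun p : ((Fin R → ℂ) × (Fin R → Slot R → ℂ) × (Slot R → ℂ)) ×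
        (Fin R → ℂ) => (p.1.1, p.2) := by fun_prop
    have h' := Measurable.comp (measurable_twist (L := L) (u := u) (M := M) l l') h
    simp only [Function.comp_def] at h'
    simp only [Function.uncurry_def]
    exact h'
  have h0 : ∀ᵐ x ∂(μ.prod (κ.prod (volume : Measure (Slot R → ℂ)))), Measure.map
      (fun f => (twist L u M l l' x.1).mulVec f) (volume : Measure (Fin R → ℂ)) = volume := by
    filter_upwards [Measure.quasiMeasurePreserving_fst.ae hμ] with x hx
    exact map_mulVec_volume (norm_det_twist hdet l l' hx)
  have h1 := measurePreserving_prod_of_ae (μ := (volume : Measure (Fin R → ℂ)))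
    (ν := μ.prod (κ.prod (volume : Measure (Slot R → ℂ)))) hm h0
  have h2 := measurePreserving_prod_add (volume : Measure (Fin R → ℂ)) μ κ
    (volume : Measure (Slot R → ℂ))
    (measurable_shift (u := u) (M := M) (P₁ := P₁) (P₂ := P₂) l l')
  -- The translation acts before the twist, because the shift is computed from the original f.
  exact h1.comp h2

lemma measurePreserving_swapMap (hdet : M.det ≠ 0) (l l' : Message L) :
    MeasurePreserving (swapMap L u M P₁ P₂ l l') (refMeasure R) (refMeasure R) :=
  measurePreserving_swapMap_of_ae hdet l l' _ _ (ae_restrict_mem measurableSet_annulus)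

end ChangeOfVariables

/-! ### Confusion of two messages by an arbitrary decoder -/

section LowerBound

variable {R K : ℕ} {L : Fin K → ℕ} {u : Slot R → Fin K → ℕ} {M : Matrix (Fin R) (Fin R) ℂ}
  {P₁ P₂ : ℝ}

variable (R) in
/-- A bounded region on which the law of the sample dominates the reference measure. -/
def boundedRegion : Set (Sample R) :=
  (Set.univ.pi fun _ => Metric.closedBall 0 1) ×ˢ (Set.univ ×ˢ (Set.univ ×ˢ
    (Set.univ.pi fun _ => Metric.closedBall 0 3)))

/-- The exchange of messages preserves Lebesgue measure in f and w, not the Gaussian law. This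
comparison carries the estimates back to the Gaussian law, on discs where its density is bounded
below. -/
lemma exists_mul_refMeasure_le (R : ℕ) : ∃ c : ENNReal, c ≠ 0 ∧ c ≠ ⊤ ∧
    ∀ E : Set (Sample R), MeasurableSet E →
      c * refMeasure R (E ∩ boundedRegion R) ≤ sampleLaw R E := by
  obtain ⟨a, ha0, ha, hale⟩ := exists_smul_restrict_le_cscg 1
  obtain ⟨b, hb0, hb, hble⟩ := exists_smul_restrict_le_cscg 3
  have h1 := smul_restrict_pi_le (ι := Fin R) hale
  have h2 := smul_restrict_pi_le (ι := Slot R) hble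
  set a' := a ^ Fintype.card (Fin R)
  set b' := b ^ Fintype.card (Slot R)
  refine ⟨a' * b', mul_ne_zero (pow_ne_zero _ ha0) (pow_ne_zero _ hb0),
    ENNReal.mul_ne_top (ENNReal.pow_ne_top ha) (ENNReal.pow_ne_top hb), fun E hE => ?_⟩
  set μ := Measure.pi fun _ : Fin R => cscg
  set κ := Measure.pi fun _ : Fin R => Measure.pi fun _ : Slot R => cscg
  set ν := Measure.pi fun _ : Slot R => cscg
  have h3 : κ.prod (b' • (volume.restrict (Set.univ.pi fun _ : Slot R => Metric.closedBall 0 3))) ≤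
      κ.prod ν := Measure.prod_mono le_rfl h2
  have h4 := Measure.prod_mono (Measure.restrict_le_self (μ := μ) (s := annulus R)) h3
  have h5 := Measure.prod_mono h1 h4
  refine le_trans (le_of_eq ?_) (h5 E)
  rw [Measure.prod_smul_right, Measure.prod_smul_right, Measure.prod_smul_left,
    Measure.prod_smul_right, Measure.smul_apply, Measure.smul_apply, smul_eq_mul, smul_eq_mul,
    mul_assoc, refMeasure, boundedRegion, ← Measure.restrict_apply hE, ← Measure.prod_restrict,
    ← Measure.prod_restrict, ← Measure.prod_restrict, Measure.restrict_univ,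
    Measure.restrict_univ]

variable (M) in
/-- The samples for which the blocks in `N` are received at the level of the noise. -/
def faded (N : Finset (Fin R)) (P : ℝ) : Set (Sample R) :=
  {ω | ω.2.1 ∈ annulus R ∧ (∀ k, ‖M.mulVec (ω.2.1 * ω.1) k‖ ^ 2 ≤ if k ∈ N then P⁻¹ else 1) ∧
    ∀ t, ‖ω.2.2.2 t‖ ≤ 1}

lemma measurableSet_faded (N : Finset (Fin R)) (P : ℝ) : MeasurableSet (faded M N P) := by
  have h1 : MeasurableSet {ω : Sample R | ω.2.1 ∈ annulus R} :=
    (measurable_fst.comp measurable_snd) measurableSet_annulus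
  have h2 : MeasurableSet {ω : Sample R | ∀ k, ‖M.mulVec (ω.2.1 * ω.1) k‖ ^ 2 ≤
      if k ∈ N then P⁻¹ else 1} := by
    rw [Set.ofPred_forall]
    refine MeasurableSet.iInter fun k => measurableSet_le ?_ measurable_const
    simp only [Matrix.mulVec, dotProduct, Pi.mul_apply]
    fun_prop
  have h3 : MeasurableSet {ω : Sample R | ∀ t, ‖ω.2.2.2 t‖ ≤ 1} := by
    rw [Set.ofPred_forall]
    refine MeasurableSet.iInter fun k => measurableSet_le ?_ measurable_const
    fun_prop
  exact h1.inter (h2.inter h3)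

/-- The volume of the fadings `f` for which the blocks in `N` are received at noise level. -/
lemma volume_faded_ge (hdet : M.det ≠ 0) (N : Finset (Fin R)) {P : ℝ} (hP : 0 < P)
    {g : Fin R → ℂ} (hg : g ∈ annulus R) :
    ENNReal.ofReal (((‖M.det‖ * 2 ^ R) ^ 2)⁻¹) *
        (ENNReal.ofReal (P⁻¹ ^ N.card) * ENNReal.ofReal Real.pi ^ R) ≤
      volume {f : Fin R → ℂ | ∀ k, ‖M.mulVec (g * f) k‖ ^ 2 ≤ if k ∈ N then P⁻¹ else 1} := by
  have hgp : 0 < ∏ j, ‖g j‖ :=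
    Finset.prod_pos fun j _ => norm_pos_iff.2 (ne_zero_of_mem_annulus hg j)
  -- The outer radius of the annulus bounds the Jacobian of f ↦ M(g f) uniformly in g.
  have hg2 : ∏ j, ‖g j‖ ≤ 2 ^ R := by
    calc ∏ j, ‖g j‖ ≤ ∏ _j : Fin R, (2 : ℝ) :=
          Finset.prod_le_prod (fun j _ => norm_nonneg _) fun j _ => (hg j (Set.mem_univ j)).2
      _ = 2 ^ R := by simp
  have hMp : 0 < ‖M.det‖ := norm_pos_iff.2 hdet
  have hd : ‖(M * Matrix.diagonal g).det‖ = ‖M.det‖ * ∏ j, ‖g j‖ := by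
    rw [Matrix.det_mul, Matrix.det_diagonal, norm_mul, norm_prod]
  have h1 : {f : Fin R → ℂ | ∀ k, ‖M.mulVec (g * f) k‖ ^ 2 ≤ if k ∈ N then P⁻¹ else 1} =
      (fun f => (M * Matrix.diagonal g).mulVec f) ⁻¹'
        {v | ∀ k, ‖v k‖ ^ 2 ≤ if k ∈ N then P⁻¹ else 1} := by
    have : ∀ f : Fin R → ℂ, (M * Matrix.diagonal g).mulVec f = M.mulVec (g * f) := fun f => by
      rw [← Matrix.mulVec_mulVec]
      congr 1
      ext j
      simp [Matrix.mulVec_diagonal]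
    ext f
    simp only [Set.mem_ofPred_eq, Set.mem_preimage, this]
  rw [h1, volume_preimage_mulVec (by rw [← norm_pos_iff, hd]; positivity), volume_polydisc N hP,
    Fintype.card_fin, hd]
  gcongr

/-- Fubini: the volume bound for f is uniform over g in the annulus and w in the unit polydisc, a
set of positive measure independent of P. -/
lemma exists_mul_le_refMeasure_faded (hdet : M.det ≠ 0) (N : Finset (Fin R)) :
    ∃ c : ENNReal, c ≠ 0 ∧ c ≠ ⊤ ∧ ∀ P : ℝ, 0 < P →
      c * ENNReal.ofReal (P⁻¹ ^ N.card) ≤ refMeasure R (faded M N P) := by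
  set μ := Measure.pi fun _ : Fin R => cscg with hμ
  set κ := Measure.pi fun _ : Fin R => Measure.pi fun _ : Slot R => cscg with hκ
  set W : Set (Slot R → ℂ) := Set.univ.pi fun _ => Metric.closedBall 0 1 with hW
  have hWm : MeasurableSet W :=
    MeasurableSet.univ_pi fun _ => Metric.isClosed_closedBall.measurableSet
  set S : Set ((Fin R → ℂ) × (Fin R → Slot R → ℂ) × (Slot R → ℂ)) :=
    annulus R ×ˢ (Set.univ ×ˢ W) with hS
  have hSm : MeasurableSet S := measurableSet_annulus.prod (MeasurableSet.univ.prod hWm)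
  set ρ := (μ.restrict (annulus R)).prod (κ.prod (volume : Measure (Slot R → ℂ))) with hρ
  have hρS : ρ S = μ (annulus R) * volume W := by
    rw [hρ, hS, Measure.prod_prod, Measure.prod_prod, Measure.restrict_apply_self, measure_univ,
      one_mul]
  have hW0 : volume W ≠ 0 := by
    rw [hW, volume_pi_pi, Finset.prod_ne_zero_iff]
    exact fun _ _ => (Metric.measure_closedBall_pos volume _ one_pos).ne'
  have hWt : volume W ≠ ⊤ := by
    rw [hW, volume_pi_pi]
    exact ENNReal.prod_ne_top fun _ _ => measure_closedBall_lt_top.ne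
  have hMp : 0 < ‖M.det‖ := norm_pos_iff.2 hdet
  set d := ENNReal.ofReal (((‖M.det‖ * 2 ^ R) ^ 2)⁻¹) with hd
  have hd0 : d ≠ 0 := by
    rw [hd, ne_eq, ENNReal.ofReal_eq_zero, not_le]; positivity
  have hpi0 : ENNReal.ofReal Real.pi ≠ 0 := by
    rw [ne_eq, ENNReal.ofReal_eq_zero, not_le]; exact Real.pi_pos
  refine ⟨d * ENNReal.ofReal Real.pi ^ R * (μ (annulus R) * volume W), ?_, ?_, fun P hP => ?_⟩
  · exact mul_ne_zero (mul_ne_zero hd0 (pow_ne_zero _ hpi0)) (mul_ne_zero annulus_pos hW0)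
  · exact ENNReal.mul_ne_top (ENNReal.mul_ne_top ENNReal.ofReal_ne_top
      (ENNReal.pow_ne_top ENNReal.ofReal_ne_top)) (ENNReal.mul_ne_top (measure_ne_top _ _) hWt)
  · have h1 : refMeasure R (faded M N P) =
        ∫⁻ x, volume ((fun f => ((f, x) : Sample R)) ⁻¹' faded M N P) ∂ρ :=
      Measure.prod_apply_symm (measurableSet_faded N P)
    rw [h1, ← hρS]
    calc d * ENNReal.ofReal Real.pi ^ R * ρ S * ENNReal.ofReal (P⁻¹ ^ N.card)
        = d * (ENNReal.ofReal (P⁻¹ ^ N.card) * ENNReal.ofReal Real.pi ^ R) * ρ S := by ring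
      _ = ∫⁻ x, S.indicator (fun _ => d * (ENNReal.ofReal (P⁻¹ ^ N.card) *
            ENNReal.ofReal Real.pi ^ R)) x ∂ρ := (lintegral_indicator_const hSm _).symm
      _ ≤ _ := by
          refine lintegral_mono fun x => ?_
          by_cases hx : x ∈ S
          · rw [Set.indicator_of_mem hx]
            refine (volume_faded_ge hdet N hP hx.1).trans (measure_mono fun f hf => ?_)
            refine ⟨hx.1, hf, fun t => ?_⟩
            have := hx.2.2 t (Set.mem_univ t)
            simpa using this
          · rw [Set.indicator_of_notMem hx]
            exact zero_le

/-- Inverting M by Mᴴ/R averages the blocks with unimodular weights, so |g_j f_j| ≤ 1; the inner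
radius of the annulus then bounds f_j. -/
lemma norm_le_of_block_le (hR : 0 < R) (hM : IsGBH M) {g f : Fin R → ℂ} (hg : g ∈ annulus R)
    (hv : ∀ k, ‖M.mulVec (g * f) k‖ ≤ 1) (j : Fin R) : ‖f j‖ ≤ 1 := by
  have hR1 : (0 : ℝ) < R := by exact_mod_cast hR
  have h1 : M.conjTranspose.mulVec (M.mulVec (g * f)) = (R : ℂ) • (g * f) := by
    rw [Matrix.mulVec_mulVec, hM.conjTranspose_mul, Matrix.smul_mulVec, Matrix.one_mulVec]
  have h2 := congrFun h1 j
  set v := M.mulVec (g * f)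
  simp only [Matrix.mulVec, dotProduct, Matrix.conjTranspose_apply, Pi.smul_apply,
    Pi.mul_apply, smul_eq_mul] at h2
  have h3 := congrArg norm h2
  have h9 : ∀ i ∈ Finset.univ, ‖star (M i j) * v i‖ ≤ 1 := fun i _ => by
    rw [norm_mul, norm_star, hM.norm_entry, one_mul]
    exact hv i
  have h4 := norm_sum_le_of_le _ h9
  rw [h3, Finset.sum_const, Finset.card_univ, Fintype.card_fin, nsmul_eq_mul, norm_mul,
    Complex.norm_natCast] at h4
  have h5 := le_of_mul_le_mul_left h4 hR1
  rw [norm_mul] at h5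
  have h6 : 1 ≤ ‖g j‖ := (hg j (Set.mem_univ j)).1
  nlinarith [norm_nonneg (f j)]

lemma block_le_one {N : Finset (Fin R)} {P : ℝ} (hP : 1 ≤ P) {v : Fin R → ℂ}
    (hv : ∀ k, ‖v k‖ ^ 2 ≤ if k ∈ N then P⁻¹ else 1) (k : Fin R) : ‖v k‖ ≤ 1 := by
  have h1 : (if k ∈ N then P⁻¹ else 1) ≤ (1 : ℝ) := by
    split_ifs
    · exact inv_le_one_of_one_le₀ hP
    · exact le_rfl
  exact (sq_le_one_iff₀ (norm_nonneg _)).1 ((hv k).trans h1)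

lemma faded_subset (hR : 0 < R) (hM : IsGBH M) (N : Finset (Fin R)) {P : ℝ} (hP : 1 ≤ P) :
    faded M N P ⊆ boundedRegion R := by
  rintro ω ⟨hg, hv, hw⟩
  refine ⟨fun j _ => ?_, Set.mem_univ _, Set.mem_univ _, fun t _ => ?_⟩
  · simpa using norm_le_of_block_le hR hM hg (block_le_one hP hv) j
  · have := hw t
    simp only [mem_closedBall_zero_iff]
    linarith

/-- The twist keeps the moduli of the blocks, and |w_t| grows from at most 1 to at most 1 + 2. This
explains the radius 3 of the region. -/
lemma swapMap_mem_boundedRegion (hR : 0 < R) (hM : IsGBH M) (l l' : Message L)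
    (N : Finset (Fin R))
    (hN : ∀ i ∉ N, phase L u l (Sum.inl i) * phase L u l' (Sum.inr i) =
      phase L u l (Sum.inr i) * phase L u l' (Sum.inl i)) {P : ℝ} (hP : 1 ≤ P)
    (hgain : P₁ * P₂ / (P₁ + 1) ≤ P) {ω : Sample R} (hω : ω ∈ faded M N P) :
    swapMap L u M P₁ P₂ l l' ω ∈ boundedRegion R := by
  obtain ⟨hg, hv, hw⟩ := hω
  have hdet := hM.det_ne_zero hR
  refine ⟨fun j _ => ?_, Set.mem_univ _, Set.mem_univ _, fun t _ => ?_⟩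
  · simp only [mem_closedBall_zero_iff]
    refine norm_le_of_block_le hR hM hg (fun k => ?_) j
    have := congrFun (mulVec_twist (L := L) (u := u) hdet l l' hg ω.1) k
    simp only [swapMap]
    rw [this, Pi.mul_apply, norm_mul, norm_turn, one_mul]
    exact block_le_one hP hv k
  · simp only [mem_closedBall_zero_iff]
    have h1 := norm_shift_le (L := L) (u := u) hdet l l' hg N hN (by linarith) hgain hv t
    refine (norm_add_le _ _).trans ?_
    linarith [hw t]

lemma measurable_destReceived (hR : 0 < R) (hP₁ : 0 ≤ P₁) (hP₂ : 0 ≤ P₂) (l : Message L) :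
    Measurable fun ω : Sample R => destReceived P₁ P₂ M (sourceVector L u l) ω := by
  have h1 : Measurable fun ω : Sample R =>
      (channelMatrix L u M P₁ P₂ l (destFading ω)).mulVec ω.1 + noise P₁ P₂ M ω := by
    have h2 : Measurable fun ω : Sample R => (ω.2.1, ω.1) := by fun_prop
    have h3 := Measurable.comp
      (measurable_channelMatrix_mulVec (u := u) (M := M) (P₁ := P₁) (P₂ := P₂) l) h2
    refine Measurable.add h3 (measurable_pi_lambda _ fun t => ?_)
    simp only [noise]
    fun_prop
  simpa only [destReceived_eq hR hP₁ hP₂] using h1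

/-- For any decoder, two messages which agree outside the blocks in `N` are confused with a
probability of the order of `P ^ (-|N|)` at least. -/
lemma exists_mul_le_error_add_error (hR : 0 < R) (hM : IsGBH M) (l l' : Message L) (hl : l ≠ l')
    (N : Finset (Fin R))
    (hN : ∀ i ∉ N, phase L u l (Sum.inl i) * phase L u l' (Sum.inr i) =
      phase L u l (Sum.inr i) * phase L u l' (Sum.inl i)) :
    ∃ c : ENNReal, c ≠ 0 ∧ c ≠ ⊤ ∧ ∀ P₁ P₂ P : ℝ, 0 ≤ P₁ → 0 ≤ P₂ → 1 ≤ P →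
      P₁ * P₂ / (P₁ + 1) ≤ P → ∀ dec : (Fin R → ℂ) → (Slot R → ℂ) → Message L,
      Measurable (Function.uncurry dec) →
      c * ENNReal.ofReal (P⁻¹ ^ N.card) ≤
        sampleLaw R {ω | dec (destFading ω)
          (destReceived P₁ P₂ M (sourceVector L u l) ω) ≠ l} +
        sampleLaw R {ω | dec (destFading ω)
          (destReceived P₁ P₂ M (sourceVector L u l') ω) ≠ l'} := by
  have hdet := hM.det_ne_zero hR
  obtain ⟨a, ha0, ha, hale⟩ := exists_mul_refMeasure_le R
  obtain ⟨b, hb0, hb, hble⟩ := exists_mul_le_refMeasure_faded hdet N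
  refine ⟨a * b, mul_ne_zero ha0 hb0, ENNReal.mul_ne_top ha hb, ?_⟩
  intro P₁ P₂ P hP₁ hP₂ hP hgain dec hdec
  have hP0 : 0 < P := by linarith
  have hEm : ∀ m : Message L, MeasurableSet {ω : Sample R | dec (destFading ω)
      (destReceived P₁ P₂ M (sourceVector L u m) ω) ≠ m} := by
    intro m
    have h1 : Measurable fun ω : Sample R => (destFading ω,
        destReceived P₁ P₂ M (sourceVector L u m) ω) :=
      (measurable_fst.comp measurable_snd).prodMk (measurable_destReceived hR hP₁ hP₂ m)
    exact (hdec.comp h1) (measurableSet_singleton m).compl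
  set E := {ω : Sample R | dec (destFading ω)
    (destReceived P₁ P₂ M (sourceVector L u l) ω) ≠ l} with hE
  set E' := {ω : Sample R | dec (destFading ω)
    (destReceived P₁ P₂ M (sourceVector L u l') ω) ≠ l'} with hE'
  have h1 : a * refMeasure R (faded M N P ∩ E) ≤ sampleLaw R E := by
    refine le_trans ?_ (hale E (hEm l))
    exact mul_le_mul' le_rfl
      (measure_mono fun ω hω => ⟨hω.2, faded_subset hR hM N hP hω.1⟩)
  have h2 : a * refMeasure R (faded M N P \ E) ≤ sampleLaw R E' := by
    refine le_trans ?_ (hale E' (hEm l'))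
    have hbm : MeasurableSet (boundedRegion R) := by
      refine MeasurableSet.prod ?_ (MeasurableSet.univ.prod (MeasurableSet.univ.prod ?_)) <;>
      exact MeasurableSet.univ_pi fun _ => Metric.isClosed_closedBall.measurableSet
    -- Where the decoder is right for l, the exchanged sample presents the same g and y when l' is
    -- sent, so the output is still l, now an error.
    rw [← (measurePreserving_swapMap (u := u) (P₁ := P₁) (P₂ := P₂) hdet l l').measure_preimage
      ((hEm l').inter hbm).nullMeasurableSet]
    refine mul_le_mul' le_rfl (measure_mono ?_)
    rintro ω ⟨hω, hωE⟩
    refine ⟨?_, swapMap_mem_boundedRegion hR hM l l' N hN hP hgain hω⟩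
    have h3 : dec (destFading ω) (destReceived P₁ P₂ M (sourceVector L u l) ω) = l := by
      simpa [hE] using hωE
    change dec (destFading (swapMap L u M P₁ P₂ l l' ω)) (destReceived P₁ P₂ M
      (sourceVector L u l') (swapMap L u M P₁ P₂ l l' ω)) ≠ l'
    rw [destReceived_swapMap hR hP₁ hP₂]
    change dec (destFading ω) _ ≠ l'
    rw [h3]
    exact hl
  calc a * b * ENNReal.ofReal (P⁻¹ ^ N.card) = a * (b * ENNReal.ofReal (P⁻¹ ^ N.card)) := by
        rw [mul_assoc]
    _ ≤ a * refMeasure R (faded M N P) := by gcongr; exact hble P hP0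
    _ = a * refMeasure R (faded M N P ∩ E) + a * refMeasure R (faded M N P \ E) := by
        rw [← mul_add, measure_inter_add_sdiff _ (hEm l)]
    _ ≤ _ := add_le_add h1 h2

variable {dec : ℝ → (Fin R → ℂ) → (Slot R → ℂ) → Message L}

/-- The two error probabilities are among the nonnegative terms of the average. Only the
measurability of the decoder matters, not its optimality. -/
lemma exists_le_blockErrorRate (hR : 0 < R) (hM : IsGBH M) (l l' : Message L) (hl : l ≠ l')
    (N : Finset (Fin R))
    (hN : ∀ i ∉ N, phase L u l (Sum.inl i) * phase L u l' (Sum.inr i) =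
      phase L u l (Sum.inr i) * phase L u l' (Sum.inl i))
    {α : ℝ} (hα₀ : 0 < α) (hα₁ : α < 1)
    (hdec : ∀ P : ℝ, 0 < P → IsMLDecoder (sourcePower α P) (relayPower R α P) L u M (dec P)) :
    ∃ c : ℝ, 0 < c ∧ ∀ P : ℝ, 1 ≤ P →
      c * P⁻¹ ^ N.card ≤
        blockErrorRate (sourcePower α P) (relayPower R α P) L u M (dec P) := by
  obtain ⟨c, hc0, hct, hc⟩ := exists_mul_le_error_add_error hR hM l l' hl N hN
  have hcard : (0 : ℝ) < Fintype.card (Message L) := by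
    have : Nonempty (Message L) := ⟨l⟩
    exact_mod_cast Fintype.card_pos
  refine ⟨c.toReal / Fintype.card (Message L), div_pos (ENNReal.toReal_pos hc0 hct) hcard,
    fun P hP => ?_⟩
  have hP0 : 0 < P := by linarith
  obtain ⟨hP₁, hP₂, -, -, hgain⟩ := sourcePower_relayPower_bounds hR hα₀ hα₁ hP
  have h1 := hc _ _ P hP₁ hP₂ hP hgain (dec P) (hdec P hP0).measurable
  have h2 := ENNReal.toReal_mono (ENNReal.add_ne_top.2 ⟨measure_ne_top _ _, measure_ne_top _ _⟩) h1
  rw [ENNReal.toReal_mul, ENNReal.toReal_ofReal (by positivity),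
    ENNReal.toReal_add (measure_ne_top _ _) (measure_ne_top _ _)] at h2
  rw [blockErrorRate, div_mul_eq_mul_div]
  gcongr
  refine h2.trans ?_
  rw [← Finset.sum_pair (f := fun m => (sampleLaw R {ω | dec P (destFading ω) (destReceived
    (sourcePower α P) (relayPower R α P) M (sourceVector L u m) ω) ≠ m}).toReal) hl]
  exact Finset.sum_le_univ_sum_of_nonneg fun m => ENNReal.toReal_nonneg

/-! ### Diversity order -/

lemma tendsto_add_div_log (n a : ℝ) :
    Tendsto (fun P : ℝ => n + a / Real.log P) atTop (𝓝 n) := by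
  have := (Real.tendsto_log_atTop.const_div_atTop a).const_add n
  simpa using this

lemma neg_log_div_log_le {p : ℝ → ℝ} {c : ℝ} {n : ℕ} (hc : 0 < c)
    (h : ∀ P, 1 ≤ P → c * P⁻¹ ^ n ≤ p P) {P : ℝ} (hP : 1 < P) :
    -Real.log (p P) / Real.log P ≤ n + -Real.log c / Real.log P := by
  have hlog : 0 < Real.log P := Real.log_pos hP
  have hP0 : 0 < P := by linarith
  have h1 := Real.log_le_log (by positivity) (h P hP.le)
  rw [Real.log_mul hc.ne' (by positivity), Real.log_pow, Real.log_inv] at h1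
  rw [div_le_iff₀ hlog, add_mul, div_mul_cancel₀ _ hlog.ne']
  linarith

lemma le_neg_log_div_log {p : ℝ → ℝ} {C s : ℝ} (hC : 0 < C)
    (h : ∀ P, 1 ≤ P → p P ≤ C * P ^ s) {P : ℝ} (hP : 1 < P) (hp : 0 < p P) :
    -s + -Real.log C / Real.log P ≤ -Real.log (p P) / Real.log P := by
  have hlog : 0 < Real.log P := Real.log_pos hP
  have hP0 : 0 < P := by linarith
  have h1 := Real.log_le_log hp (h P hP.le)
  rw [Real.log_mul hC.ne' (by positivity), Real.log_rpow hP0] at h1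
  rw [le_div_iff₀ hlog, add_mul, div_mul_cancel₀ _ hlog.ne']
  linarith

/-- An arbitrarily small loss δ in the exponent is harmless, since the order is a limit of
logarithmic ratios and constants disappear in it. -/
lemma hasDiversityOrder_of_bounds {p : ℝ → ℝ} {n : ℕ}
    (hlow : ∃ c : ℝ, 0 < c ∧ ∀ P, 1 ≤ P → c * P⁻¹ ^ n ≤ p P)
    (hup : ∀ δ : ℝ, 0 < δ → ∃ C : ℝ, 0 < C ∧ ∀ P : ℝ, 1 ≤ P → p P ≤ C * P ^ (δ - n)) :
    HasDiversityOrder p n := by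
  obtain ⟨c, hc, hlow⟩ := hlow
  have hpos : ∀ P : ℝ, 1 ≤ P → 0 < p P := fun P hP =>
    lt_of_lt_of_le (mul_pos hc (pow_pos (inv_pos.2 (by linarith)) n)) (hlow P hP)
  refine ⟨(eventually_ge_atTop 1).mono hpos, tendsto_order.2 ⟨fun a ha => ?_, fun a ha => ?_⟩⟩
  · obtain ⟨C, hC, hup⟩ := hup ((n - a) / 2) (by linarith)
    have h1 := (tendsto_add_div_log (-((n - a) / 2 - n)) (-Real.log C)).eventually_const_lt
      (show a < -((n - a) / 2 - n) by linarith)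
    filter_upwards [h1, eventually_gt_atTop 1] with P hP1 hP
    exact hP1.trans_le (le_neg_log_div_log hC hup hP (hpos P hP.le))
  · filter_upwards [(tendsto_add_div_log n (-Real.log c)).eventually_lt_const ha,
      eventually_gt_atTop 1] with P hP1 hP
    exact (neg_log_div_log_le hc hlow hP).trans_lt hP1

lemma HasDiversityOrder.le_of_le {p : ℝ → ℝ} {n : ℕ} {d : ℝ} (h : HasDiversityOrder p d)
    (hlow : ∃ c : ℝ, 0 < c ∧ ∀ P, 1 ≤ P → c * P⁻¹ ^ n ≤ p P) : d ≤ n := by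
  obtain ⟨c, hc, hlow⟩ := hlow
  exact le_of_tendsto_of_tendsto h.2 (tendsto_add_div_log n (-Real.log c))
    ((eventually_gt_atTop 1).mono fun P hP => neg_log_div_log_le hc hlow hP)

end LowerBound

end RelayNetwork

end

/-! ### The main theorem -/

open RelayNetwork
theorem theorem2 {R K : ℕ} (hR : 0 < R) (hK : 0 < K)
    (L : Fin K → ℕ) (u : Slot R → Fin K → ℕ)
    (hu : ∀ t ν, 1 ≤ u t ν ∧ u t ν ≤ L ν - 1)
    (M : Matrix (Fin R) (Fin R) ℂ) (hM : IsGBH M)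
    (α : ℝ) (hα₀ : 0 < α) (hα₁ : α < 1)
    (dec : ℝ → (Fin R → ℂ) → (Slot R → ℂ) → Message L)
    (hdec : ∀ P : ℝ, 0 < P →
      IsMLDecoder (sourcePower α P) (relayPower R α P) L u M (dec P)) :
    (HasDiversityOrder
        (fun P => blockErrorRate (sourcePower α P) (relayPower R α P) L u M (dec P)) (R : ℝ) ↔
      ∀ i : Fin R, ∀ l l' : Message L, l ≠ l' →
        ¬ ∃ z : ℤ, ∑ ν, (((l ν : ℕ) : ℝ) - ((l' ν : ℕ) : ℝ)) *
          ((u (Sum.inl i) ν : ℝ) - (u (Sum.inr i) ν : ℝ)) / (L ν : ℝ) = (z : ℝ)) ∧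
    (DetCriterion L u M ↔
      ∀ i : Fin R, ∀ l l' : Message L, l ≠ l' →
        ¬ ∃ z : ℤ, ∑ ν, (((l ν : ℕ) : ℝ) - ((l' ν : ℕ) : ℝ)) *
          ((u (Sum.inl i) ν : ℝ) - (u (Sum.inr i) ν : ℝ)) / (L ν : ℝ) = (z : ℝ)) := by
  simp only [← phase_mul_eq_iff]
  refine ⟨⟨fun hdiv i l l' hl heq => ?_, fun hsep => ?_⟩, ?_⟩
  -- If the lines of l and l' agree in block i, N may omit i, and the order is at most R - 1.
  · have h1 := hdiv.le_of_le (exists_le_blockErrorRate hR hM l l' hl (Finset.univ.erase i)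
      (fun j hj => by
        have : j = i := by simpa using hj
        rw [this]
        exact heq) hα₀ hα₁ hdec)
    rw [Finset.card_erase_of_mem (Finset.mem_univ i), Finset.card_univ, Fintype.card_fin] at h1
    have h2 : R ≤ R - 1 := by exact_mod_cast h1
    omega
  · have hL : ∀ ν, 1 < L ν := fun ν => by
      have := hu (Sum.inl ⟨0, hR⟩) ν
      omega
    -- The lower bound needs two distinct messages: they exist because K > 0 and the range of u
    -- forces L_ν ≥ 2. With N all blocks, no agreement between their lines is required.
    have hne : (fun ν => ⟨0, (hL ν).pos⟩ : Message L) ≠ fun ν => ⟨1, hL ν⟩ := fun h => by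
      simpa using congrFun h ⟨0, hK⟩
    refine hasDiversityOrder_of_bounds ?_ fun δ hδ =>
      exists_blockErrorRate_le hR hM (fun l l' hl i => hsep i l l' hl) hα₀ hα₁ hdec hδ
    have h1 := exists_le_blockErrorRate hR hM _ _ hne Finset.univ
      (fun i hi => absurd (Finset.mem_univ i) hi) hα₀ hα₁ hdec
    rwa [Finset.card_univ, Fintype.card_fin] at h1
  · unfold DetCriterion
    simp only [det_fromCols_codeword_ne_zero_iff hR hM]
    exact ⟨fun h i l l' hl => h l l' hl i, fun h l l' hl i => h i l l' hl⟩
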